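/- Let $0<\alpha\le 1$. For $\varphi:[0,1]\to\mathbb C$ put $\|\varphi\|_\alpha=\sup_x|\varphi(x)|+\sup_{x\ne y}\frac{|\varphi(x)-\varphi(y)|}{|x-y|^\alpha}$ and let $\mathcal H_\alpha[0,1]$ be the space of all $\varphi$ with $\|\varphi\|_\alpha<\infty$. Let $p:[0,1]\to[0,1]$ be $\alpha$-Hölder and $q=1-p$. The Diaconis–Friedman chain $(Z_n)_{n\ge0}$ with weights $p,q$ is the Markov chain on $[0,1]$ which moves from $x$ to $tx$ with probability $p(x)$ and to $tx+1-t$ with probability $q(x)$, where $t$ is uniform on $[0,1]$; its transition operator is $$Q\varphi(x)=p(x)\int_0^1\varphi(tx)\,dt+q(x)\int_0^1\varphi(tx+1-t)\,dt ,$$ and $\mathbb P_x$ denotes the law of the chain started at $Z_0=x$. For an operator $L$ on $\mathcal H_\alpha[0,1]$, say that $Q^n\to L$ exponentially if there are $\kappa>0$ and $\rho\in[0,1)$ such that for all $\varphi\in\mathcal H_\alpha[0,1]$ and $n\ge0$, $$|Q^n\varphi(x)-L\varphi(x)|\le\kappa\rho^n\|\varphi\|_\alpha\quad\text{for all }x\in[0,1],\qquad\text{and}\qquad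 \|Q^n\varphi-L\varphi\|_\alpha\le\kappa\rho^n\|\varphi\|_\alpha .$$ (1) If $p(0)<1$ and $q(1)<1$, there is a unique $Q$-invariant probability measure $\nu_p$ on $[0,1]$. It is absolutely continuous with respect to Lebesgue measure, with density $$f_p(x)=C\exp\Bigl(\int_x^{1/2}\frac{p(y)}{y}\,dy+\int_{1/2}^x\frac{q(y)}{1-y}\,dy\Bigr)\qquad(0<x<1),$$ where $C>0$ is a normalization constant, and $Q^n\to L$ exponentially with $L\varphi(x)=\int\varphi\,d\nu_p$. (2) If $p(0)=1$ and $q(1)<1$, then $\delta_0$ is the unique $Q$-invariant probability measure, and $Q^n\to L$ exponentially with $L\varphi(x)=\varphi(0)$. If $p(0)<1$ and $q(1)=1$, then $\delta_1$ is the unique $Q$-invariant probability measure, and $Q^n\to L$ exponentially with $L\varphi(x)=\varphi(1)$. (3) If $p(0)=1$ and $q(1)=1$, the $Q$-invariant probability measures are exactly the convex combinations of $\delta_0$ and $\delta_1$. There is a unique $h\in\mathcal H_\alpha[0,1]$ with $Qh=h$, $h(0)=0$, $h(1)=1$; it is real-valued. For every $x\in[0,1]$, $(Z_n)$ converges $\mathbb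 P_x$-almost surely to a random variable $Z_\infty$ with values in $\{0,1\}$, and $\mathbb P_x(Z_\infty=0)=1-h(x)$, $\mathbb P_x(Z_\infty=1)=h(x)$. Moreover $Q^n\to L$ exponentially with $L\varphi(x)=(1-h(x))\varphi(0)+h(x)\varphi(1)$. -/

import Mathlib

open MeasureTheory ProbabilityTheory Filter Topology unitInterval
open scoped NNReal ENNReal

noncomputable section

namespace DiaconisFriedman

/-- The homothety `H_t : x ↦ t x` of `[0,1]`. -/
def homothety (t x : I) : I := ⟨(t : ℝ) * x, unitInterval.mul_mem t.2 x.2⟩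

/-- The affine map `A_t : x ↦ t x + 1 - t` of `[0,1]`. -/
def affineMap (t x : I) : I :=
  ⟨(t : ℝ) * x + 1 - t, by
    obtain ⟨ht0, ht1⟩ := t.2
    obtain ⟨hx0, hx1⟩ := x.2
    constructor <;> nlinarith [mul_nonneg ht0 hx0, mul_nonneg ht0 (sub_nonneg.2 hx1)]⟩

lemma continuous_homothety : Continuous (fun z : I × I => homothety z.1 z.2) := by
  unfold homothety
  fun_prop

lemma continuous_affineMap : Continuous (fun z : I × I => affineMap z.1 z.2) := by
  unfold affineMap
  fun_prop

lemma measurable_homothety (x : I) : Measurable (fun t : I => homothety t x) :=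
  (continuous_homothety.comp (Continuous.prodMk_left x)).measurable

lemma measurable_affineMap (x : I) : Measurable (fun t : I => affineMap t x) :=
  (continuous_affineMap.comp (Continuous.prodMk_left x)).measurable

/-- The complementary weight `q = 1 - p`. -/
def qWeight (p : C(I, I)) (x : I) : I := σ (p x)

/-- The law of the position after one step from `x`: with `t` uniform on `[0,1]`, the chain moves
to `H_t x` with probability `p x` and to `A_t x` with probability `q x = 1 - p x`. -/
def stepLaw (p : C(I, I)) (x : I) : Measure I :=
  ENNReal.ofReal (p x) • (volume : Measure I).map (fun t => homothety t x) +
    ENNReal.ofReal (qWeight p x) • (volume : Measure I).map (fun t => affineMap t x)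

lemma measurable_map_of_continuous {T : I → I → I}
    (hT : Continuous (fun z : I × I => T z.1 z.2)) :
    Measurable (fun x : I => (volume : Measure I).map (fun t => T t x)) := by
  refine Measure.measurable_of_measurable_coe _ fun s hs => ?_
  have h : ∀ x : I, (volume : Measure I).map (fun t => T t x) s
      = (volume : Measure I) ((fun t => (x, t)) ⁻¹' ((fun z : I × I => T z.2 z.1) ⁻¹' s)) :=
    fun x => Measure.map_apply (hT.comp (Continuous.prodMk_left x)).measurable hs
  simp_rw [h]
  exact measurable_measure_prodMk_left ((hT.comp continuous_swap).measurable hs)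

lemma measurable_stepLaw (p : C(I, I)) : Measurable (stepLaw p) := by
  have h1 := measurable_map_of_continuous continuous_homothety
  have h2 := measurable_map_of_continuous continuous_affineMap
  have hp : Measurable (fun x : I => ENNReal.ofReal (p x)) := by
    have := p.continuous
    exact ENNReal.measurable_ofReal.comp (by fun_prop : Continuous fun x : I => (p x : ℝ)).measurable
  have hq : Measurable (fun x : I => ENNReal.ofReal (qWeight p x)) := by
    have := p.continuous
    unfold qWeight
    exact ENNReal.measurable_ofReal.comp
      (by fun_prop : Continuous fun x : I => ((σ (p x) : I) : ℝ)).measurable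
  refine Measure.measurable_of_measurable_coe _ fun s hs => ?_
  simp only [stepLaw, Measure.add_apply, Measure.smul_apply, smul_eq_mul]
  exact (hp.mul ((Measure.measurable_coe hs).comp h1)).add
    (hq.mul ((Measure.measurable_coe hs).comp h2))

/-- The transition kernel of the chain with weights `p` and `q = 1 - p`. -/
def transKernel (p : C(I, I)) : Kernel I I where
  toFun := stepLaw p
  measurable' := measurable_stepLaw p

instance (p : C(I, I)) : IsMarkovKernel (transKernel p) where
  isProbabilityMeasure x := by
    have h1 := Measure.isProbabilityMeasure_map (μ := (volume : Measure I))
      (measurable_homothety x).aemeasurable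
    have h2 := Measure.isProbabilityMeasure_map (μ := (volume : Measure I))
      (measurable_affineMap x).aemeasurable
    constructor
    change stepLaw p x Set.univ = 1
    simp only [stepLaw, Measure.add_apply, Measure.smul_apply, smul_eq_mul, measure_univ, mul_one]
    rw [← ENNReal.ofReal_add (p x).2.1 (qWeight p x).2.1]
    simp [qWeight]

/-- The transition operator
`Q φ (x) = p(x) ∫₀¹ φ(t x) dt + q(x) ∫₀¹ φ(t x + 1 - t) dt`. -/
def transOp (p : C(I, I)) (φ : I → ℂ) (x : I) : ℂ :=
  ((p x : ℝ) : ℂ) * (∫ t : I, φ (homothety t x)) +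
    ((qWeight p x : ℝ) : ℂ) * (∫ t : I, φ (affineMap t x))

/-- The operator `Q` is integration against the transition kernel. -/
lemma transOp_eq_integral (p : C(I, I)) {φ : I → ℂ} (hφ : Measurable φ) {M : ℝ}
    (hM : ∀ x, ‖φ x‖ ≤ M) (x : I) : transOp p φ x = ∫ y, φ y ∂(transKernel p x) := by
  have h1 := Measure.isProbabilityMeasure_map (μ := (volume : Measure I))
    (measurable_homothety x).aemeasurable
  have h2 := Measure.isProbabilityMeasure_map (μ := (volume : Measure I))
    (measurable_affineMap x).aemeasurable
  have hi : ∀ ν : Measure I, IsProbabilityMeasure ν → Integrable φ ν := fun ν _ =>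
    Integrable.of_bound hφ.aestronglyMeasurable M (Eventually.of_forall hM)
  change _ = ∫ y, φ y ∂(stepLaw p x)
  rw [stepLaw, integral_add_measure ((hi _ h1).smul_measure ENNReal.ofReal_ne_top)
    ((hi _ h2).smul_measure ENNReal.ofReal_ne_top), integral_smul_measure, integral_smul_measure,
    integral_map (measurable_homothety x).aemeasurable hφ.aestronglyMeasurable,
    integral_map (measurable_affineMap x).aemeasurable hφ.aestronglyMeasurable,
    ENNReal.toReal_ofReal (p x).2.1, ENNReal.toReal_ofReal (qWeight p x).2.1]
  simp [transOp]

/-- `ν` is a `Q`-invariant probability measure on `[0,1]`. -/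
def IsInvariantProb (p : C(I, I)) (ν : Measure I) : Prop :=
  IsProbabilityMeasure ν ∧ Kernel.Invariant (transKernel p) ν

/-- The law `ℙ_x` on the path space of the chain `(Z_n)` started at `Z_0 = x`; on that space,
`Z_n` is the `n`-th coordinate. -/
def pathLaw (p : C(I, I)) (x : I) : Measure (ℕ → I) :=
  Kernel.trajMeasure (X := fun _ => I) (Measure.dirac x) fun n =>
    (transKernel p).comap (fun z : (i : Finset.Iic n) → I => z ⟨n, Finset.mem_Iic.2 le_rfl⟩)
      (measurable_pi_apply _)

/-- The norm `‖φ‖_α = |φ|_∞ + m_α(φ)` on the space `H_α[0,1]` of `α`-Hölder functions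
(those with `MemHolder α φ`). -/
def holderNorm (α : ℝ≥0) (φ : I → ℂ) : ℝ := (⨆ x, ‖φ x‖) + nnHolderNorm α φ

/-- The iterates of `Q` converge to `L` on `H_α[0,1]` at an exponential rate: pointwise, uniformly
in `x`, and in the norm of `H_α[0,1]`. -/
def ConvergesExponentially (α : ℝ≥0) (p : C(I, I)) (L : (I → ℂ) → I → ℂ) : Prop :=
  ∃ κ ρ : ℝ, 0 < κ ∧ 0 ≤ ρ ∧ ρ < 1 ∧ ∀ φ : I → ℂ, MemHolder α φ → ∀ n : ℕ,
    (∀ x : I, ‖(transOp p)^[n] φ x - L φ x‖ ≤ κ * ρ ^ n * holderNorm α φ) ∧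
    MemHolder α ((transOp p)^[n] φ - L φ) ∧
    holderNorm α ((transOp p)^[n] φ - L φ) ≤ κ * ρ ^ n * holderNorm α φ

/-- The unnormalized density
`exp (∫_x^{1/2} p(y)/y dy + ∫_{1/2}^x q(y)/(1-y) dy)`. It is meaningful for `0 < x < 1`; the two
end points are Lebesgue-null. -/
def unnormalizedDensity (p : C(I, I)) (x : I) : ℝ :=
  Real.exp ((∫ y in (x : ℝ)..(1 / 2), (p (Set.projIcc 0 1 zero_le_one y) : ℝ) / y) +
    ∫ y in (1 / 2)..(x : ℝ), (qWeight p (Set.projIcc 0 1 zero_le_one y) : ℝ) / (1 - y))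

end DiaconisFriedman

end

open DiaconisFriedman

noncomputable section

namespace DiaconisFriedman

/-! Everything reduces to exponential decay in the sup norm. For `t` uniform, both maps `H_t` and
`A_t` contract distances by `t`, so averaging multiplies a Hölder seminorm by `∫ t^α dt = 1/(1+α) <
1`; the variation of `p`, with Hölder constant `K`, costs only `2K` times the sup norm. This
Doeblin–Fortet inequality (`dist_transOp_le`) turns sup-norm decay of `Q^n φ - L φ` into decay in
the Hölder norm (`convergesExponentially_of_sup`).

With an absorbing end point, the decay comes from a Lyapunov function `W` satisfying `Q W ≤ ρ W`
with `ρ < 1`, comparable to the `α`-th power of the distance to the absorbing set near that set.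
Close to an absorbing end the average move contracts this power by `1/(1+α)`, while the opposite
move has probability of the same small order as the power itself. Elsewhere a step reaches an end
zone with a probability bounded below, which makes the mean of `W` drop. If `φ - L φ` vanishes on
the absorbing set, it is at most a constant times `W`, hence its iterates decay like `ρ^n`.
Invariant laws live on the zeros of `W`.

With two absorbing ends, `h` is the limit of `Q^n` applied to `x ↦ x`. Along the paths both `E
V(Z_n)` and `E |Z_{n+1} - Z_n|` are `O(ρ^n)`, where `V` is the Lyapunov function, so almost every
path converges to a zero of `V`; since `E h(Z_n) = h(x)`, the value `h(x)` is the probability of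
ending at `1`.

With no absorbing end, two steps satisfy Doeblin's minorization: one step reaches an end zone from
anywhere, and from there the next one dominates a multiple of Lebesgue measure on `[s, 1-s]`.
Oscillations therefore decay, which gives uniqueness and convergence. For existence, `f' = f (-p/x +
q/(1-x))` makes `f (Q u - u)` an exact derivative whose boundary terms vanish. -/

/-! ### Uniform averages, the kernel and Hölder bounds -/

lemma integral_unitInterval {E : Type*} [NormedAddCommGroup E] [NormedSpace ℝ E] (f : ℝ → E) :
    ∫ t : I, f t = ∫ t in (0 : ℝ)..1, f t := by
  rw [integral_subtype measurableSet_Icc, intervalIntegral.integral_of_le zero_le_one,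
    integral_Icc_eq_integral_Ioc]

lemma integral_rpow_unitInterval (α : ℝ≥0) : ∫ t : I, (t : ℝ) ^ (α : ℝ) = (1 + (α : ℝ))⁻¹ := by
  rw [integral_unitInterval (fun t => t ^ (α : ℝ)), integral_rpow (Or.inl (by linarith [α.2]))]
  rw [Real.one_rpow, Real.zero_rpow (by positivity), sub_zero, add_comm, one_div]

/-- The contraction factor of the Hölder seminorm under one step of the chain. -/
def holderRate (α : ℝ≥0) : ℝ := (1 + (α : ℝ))⁻¹

lemma holderRate_pos (α : ℝ≥0) : 0 < holderRate α := by unfold holderRate; positivity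

lemma holderRate_lt_one {α : ℝ≥0} (hα : 0 < α) : holderRate α < 1 := by
  unfold holderRate
  exact inv_lt_one_of_one_lt₀ (by have : (0 : ℝ) < α := hα; linarith)

lemma coe_qWeight (p : C(I, I)) (x : I) : (qWeight p x : ℝ) = 1 - p x := rfl

lemma coe_homothety (t x : I) : (homothety t x : ℝ) = t * x := rfl

lemma coe_affineMap (t x : I) : (affineMap t x : ℝ) = t * x + 1 - t := rfl

lemma continuous_homothety_left (x : I) : Continuous (fun t : I => homothety t x) :=
  continuous_homothety.comp (Continuous.prodMk_left x)

lemma continuous_affineMap_left (x : I) : Continuous (fun t : I => affineMap t x) :=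
  continuous_affineMap.comp (Continuous.prodMk_left x)

lemma integral_transKernel {E : Type*} [NormedAddCommGroup E] [NormedSpace ℝ E] (p : C(I, I))
    {φ : I → E} (hφ : StronglyMeasurable φ) {M : ℝ} (hM : ∀ x, ‖φ x‖ ≤ M) (x : I) :
    ∫ y, φ y ∂(transKernel p x) = (p x : ℝ) • (∫ t : I, φ (homothety t x)) +
      (qWeight p x : ℝ) • (∫ t : I, φ (affineMap t x)) := by
  have h1 := Measure.isProbabilityMeasure_map (μ := (volume : Measure I))
    (measurable_homothety x).aemeasurable
  have h2 := Measure.isProbabilityMeasure_map (μ := (volume : Measure I))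
    (measurable_affineMap x).aemeasurable
  have hi : ∀ ν : Measure I, IsProbabilityMeasure ν → Integrable φ ν := fun ν _ =>
    Integrable.of_bound hφ.aestronglyMeasurable M (Eventually.of_forall hM)
  change ∫ y, φ y ∂(stepLaw p x) = _
  rw [stepLaw, integral_add_measure ((hi _ h1).smul_measure ENNReal.ofReal_ne_top)
    ((hi _ h2).smul_measure ENNReal.ofReal_ne_top), integral_smul_measure, integral_smul_measure,
    integral_map (measurable_homothety x).aemeasurable hφ.aestronglyMeasurable,
    integral_map (measurable_affineMap x).aemeasurable hφ.aestronglyMeasurable,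
    ENNReal.toReal_ofReal (p x).2.1, ENNReal.toReal_ofReal (qWeight p x).2.1]

lemma exists_norm_le_of_continuous {E : Type*} [NormedAddCommGroup E] {φ : I → E}
    (hφ : Continuous φ) : ∃ M, ∀ x, ‖φ x‖ ≤ M := by
  obtain ⟨M, hM⟩ := isCompact_univ.exists_bound_of_continuousOn hφ.continuousOn
  exact ⟨M, fun x => hM x trivial⟩

lemma integrable_of_continuous {E : Type*} [NormedAddCommGroup E]
    [SecondCountableTopology E] [MeasurableSpace E] [BorelSpace E]
    {φ : I → E} (hφ : Continuous φ) (μ : Measure I) [IsFiniteMeasure μ] : Integrable φ μ := by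
  obtain ⟨M, hM⟩ := exists_norm_le_of_continuous hφ
  exact Integrable.of_bound hφ.measurable.aestronglyMeasurable M (Eventually.of_forall hM)

lemma transOp_eq_of_continuous (p : C(I, I)) {φ : I → ℂ} (hφ : Continuous φ) (x : I) :
    transOp p φ x = ∫ y, φ y ∂(transKernel p x) := by
  obtain ⟨M, hM⟩ := exists_norm_le_of_continuous hφ
  exact transOp_eq_integral p hφ.measurable hM x

lemma continuous_of_memHolder {Y : Type*} [PseudoEMetricSpace Y] {α : ℝ≥0} (hα : 0 < α)
    {φ : I → Y} (hφ : MemHolder α φ) : Continuous φ :=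
  hφ.choose_spec.continuous hα

lemma holderWith_iff {Y : Type*} [PseudoMetricSpace Y] {α C : ℝ≥0} {φ : I → Y} :
    HolderWith C α φ ↔ ∀ x y : I, dist (φ x) (φ y) ≤ C * |(x : ℝ) - y| ^ (α : ℝ) := by
  constructor
  · intro h x y
    exact h.dist_le x y
  · intro h x y
    have := ENNReal.ofReal_le_ofReal (h x y)
    rw [← edist_dist, ENNReal.ofReal_mul (NNReal.coe_nonneg C),
      ← ENNReal.ofReal_rpow_of_nonneg (abs_nonneg _) (NNReal.coe_nonneg α)] at this
    have h2 : edist x y = ENNReal.ofReal |(x : ℝ) - y| := by rw [edist_dist]; rfl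
    rw [h2]
    simpa using this

lemma memHolder_iff_exists {Y : Type*} [PseudoMetricSpace Y] {α : ℝ≥0} {φ : I → Y} :
    MemHolder α φ ↔ ∃ C : ℝ, 0 ≤ C ∧ ∀ x y : I, dist (φ x) (φ y) ≤ C * |(x : ℝ) - y| ^ (α : ℝ) := by
  constructor
  · rintro ⟨C, hC⟩
    exact ⟨C, C.2, holderWith_iff.1 hC⟩
  · rintro ⟨C, hC0, hC⟩
    exact ⟨⟨C, hC0⟩, holderWith_iff.2 hC⟩

lemma dist_le_nnHolderNorm {α : ℝ≥0} {φ : I → ℂ} (hφ : MemHolder α φ) (x y : I) :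
    dist (φ x) (φ y) ≤ nnHolderNorm α φ * |(x : ℝ) - y| ^ (α : ℝ) :=
  holderWith_iff.1 hφ.holderWith x y

lemma nnHolderNorm_le {α : ℝ≥0} {φ : I → ℂ} {C : ℝ} (hC : 0 ≤ C)
    (h : ∀ x y : I, dist (φ x) (φ y) ≤ C * |(x : ℝ) - y| ^ (α : ℝ)) :
    (nnHolderNorm α φ : ℝ) ≤ C :=
  HolderWith.nnholderNorm_le (C := ⟨C, hC⟩) (holderWith_iff.2 h)

lemma norm_le_iSup_of_continuous {φ : I → ℂ} (hφ : Continuous φ) (x : I) : ‖φ x‖ ≤ ⨆ y, ‖φ y‖ := by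
  obtain ⟨M, hM⟩ := exists_norm_le_of_continuous hφ
  exact le_ciSup (f := fun y => ‖φ y‖) ⟨M, by rintro _ ⟨y, rfl⟩; exact hM y⟩ x

lemma holderNorm_nonneg (α : ℝ≥0) (φ : I → ℂ) : 0 ≤ holderNorm α φ :=
  add_nonneg (Real.iSup_nonneg fun _ => norm_nonneg _) (NNReal.coe_nonneg _)

lemma norm_le_holderNorm {α : ℝ≥0} (hα : 0 < α) {φ : I → ℂ} (hφ : MemHolder α φ) (x : I) :
    ‖φ x‖ ≤ holderNorm α φ :=
  (norm_le_iSup_of_continuous (continuous_of_memHolder hα hφ) x).trans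
    (le_add_of_nonneg_right (NNReal.coe_nonneg _))

lemma dist_le_holderNorm {α : ℝ≥0} {φ : I → ℂ} (hφ : MemHolder α φ) (x y : I) :
    dist (φ x) (φ y) ≤ holderNorm α φ * |(x : ℝ) - y| ^ (α : ℝ) :=
  (dist_le_nnHolderNorm hφ x y).trans (by
    gcongr
    exact le_add_of_nonneg_left (Real.iSup_nonneg fun _ => norm_nonneg _))

lemma holderNorm_le {α : ℝ≥0} {φ : I → ℂ} {A C : ℝ} (hA : ∀ x, ‖φ x‖ ≤ A) (hC : 0 ≤ C)
    (h : ∀ x y : I, dist (φ x) (φ y) ≤ C * |(x : ℝ) - y| ^ (α : ℝ)) : holderNorm α φ ≤ A + C :=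
  add_le_add (ciSup_le hA) (nnHolderNorm_le hC h)

/-! ### The Doeblin–Fortet inequality and the passage from sup norm to Hölder norm -/

lemma norm_integral_le_of_forall {φ : I → ℂ} {M : ℝ} {T : I → I} (hM : ∀ x, ‖φ x‖ ≤ M) :
    ‖∫ t : I, φ (T t)‖ ≤ M := by
  simpa using norm_integral_le_of_norm_le_const (μ := (volume : Measure I))
    (Eventually.of_forall fun t => hM (T t))

lemma norm_transOp_le (p : C(I, I)) {φ : I → ℂ} {M : ℝ} (hM : ∀ x, ‖φ x‖ ≤ M) (x : I) :
    ‖transOp p φ x‖ ≤ M := by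
  have h1 := norm_integral_le_of_forall (T := fun t => homothety t x) hM
  have h2 := norm_integral_le_of_forall (T := fun t => affineMap t x) hM
  refine (norm_add_le _ _).trans ?_
  rw [norm_mul, norm_mul, Complex.norm_real, Complex.norm_real, Real.norm_of_nonneg (p x).2.1,
    Real.norm_of_nonneg (qWeight p x).2.1, coe_qWeight]
  have hp0 := (p x).2.1
  have hp1 := (p x).2.2
  nlinarith [mul_le_mul_of_nonneg_left h1 hp0, mul_le_mul_of_nonneg_left h2 (sub_nonneg.2 hp1)]

lemma norm_transOp_iterate_le (p : C(I, I)) {φ : I → ℂ} {M : ℝ} (hM : ∀ x, ‖φ x‖ ≤ M) (n : ℕ)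
    (x : I) : ‖(transOp p)^[n] φ x‖ ≤ M := by
  induction n generalizing x with
  | zero => exact hM x
  | succ n ih =>
    rw [Function.iterate_succ_apply']
    exact norm_transOp_le p ih x

lemma norm_integral_sub_le {α : ℝ≥0} {φ : I → ℂ} (hφ : Continuous φ) {C : ℝ}
    (h : ∀ x y : I, dist (φ x) (φ y) ≤ C * |(x : ℝ) - y| ^ (α : ℝ)) {T : I → I → I}
    (hT : ∀ x, Continuous fun t => T t x)
    (hd : ∀ t x y : I, (T t x : ℝ) - T t y = t * ((x : ℝ) - y)) (x y : I) :
    ‖(∫ t : I, φ (T t x)) - ∫ t : I, φ (T t y)‖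
      ≤ holderRate α * C * |(x : ℝ) - y| ^ (α : ℝ) := by
  have hi : ∀ z, Integrable (fun t : I => φ (T t z)) volume := fun z =>
    integrable_of_continuous (hφ.comp (hT z)) _
  rw [← integral_sub (hi x) (hi y)]
  have hc : Continuous fun t : I => (t : ℝ) ^ (α : ℝ) * (C * |(x : ℝ) - y| ^ (α : ℝ)) :=
    (continuous_subtype_val.rpow_const fun _ => Or.inr α.2).mul continuous_const
  refine (norm_integral_le_of_norm_le (integrable_of_continuous hc _)
    (Eventually.of_forall fun t => ?_)).trans (le_of_eq ?_)
  · rw [← dist_eq_norm]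
    refine (h _ _).trans (le_of_eq ?_)
    rw [hd, abs_mul, Real.mul_rpow (abs_nonneg _) (abs_nonneg _), abs_of_nonneg t.2.1]
    ring
  · rw [integral_mul_const, integral_rpow_unitInterval, holderRate]
    ring

/-- The Doeblin–Fortet inequality. -/
lemma dist_transOp_le {α : ℝ≥0} {p : C(I, I)} {K : ℝ}
    (hK : ∀ x y : I, |(p x : ℝ) - p y| ≤ K * |(x : ℝ) - y| ^ (α : ℝ))
    {φ : I → ℂ} (hφ : Continuous φ) {C M : ℝ}
    (h : ∀ x y : I, dist (φ x) (φ y) ≤ C * |(x : ℝ) - y| ^ (α : ℝ)) (hM : ∀ x, ‖φ x‖ ≤ M)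
    (x y : I) : dist (transOp p φ x) (transOp p φ y)
      ≤ (holderRate α * C + 2 * K * M) * |(x : ℝ) - y| ^ (α : ℝ) := by
  have h1 := norm_integral_sub_le hφ h continuous_homothety_left
    (fun t x y => by simp only [coe_homothety]; ring) x y
  have h2 := norm_integral_sub_le hφ h continuous_affineMap_left
    (fun t x y => by simp only [coe_affineMap]; ring) x y
  have h3 := norm_integral_le_of_forall (T := fun t => homothety t y) hM
  have h4 := norm_integral_le_of_forall (T := fun t => affineMap t y) hM
  set a := ∫ t : I, φ (homothety t x)
  set a' := ∫ t : I, φ (homothety t y)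
  set b := ∫ t : I, φ (affineMap t x)
  set b' := ∫ t : I, φ (affineMap t y)
  -- The base point moves with the weights frozen at `x`, then the weights change. Since `q = 1 -
  -- p`, the change of weights contributes the single product `(p x - p y) (a' - b')`.
  have e : transOp p φ x - transOp p φ y = ((p x : ℝ) : ℂ) * (a - a') +
      ((qWeight p x : ℝ) : ℂ) * (b - b') + (((p x : ℝ) - p y : ℝ) : ℂ) * (a' - b') := by
    simp only [transOp, coe_qWeight]
    push_cast
    ring
  rw [dist_eq_norm, e]
  refine (norm_add₃_le).trans ?_
  rw [norm_mul, norm_mul, norm_mul, Complex.norm_real, Complex.norm_real, Complex.norm_real,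
    Real.norm_of_nonneg (p x).2.1, Real.norm_of_nonneg (qWeight p x).2.1, coe_qWeight,
    Real.norm_eq_abs]
  have hp0 := (p x).2.1
  have hp1 := (p x).2.2
  have h5 : ‖a' - b'‖ ≤ 2 * M := (norm_sub_le _ _).trans (by linarith)
  have h6 := mul_le_mul (hK x y) h5 (norm_nonneg _) ((abs_nonneg _).trans (hK x y))
  nlinarith [mul_le_mul_of_nonneg_left h1 hp0, mul_le_mul_of_nonneg_left h2 (sub_nonneg.2 hp1)]

lemma exists_weight_bound {α : ℝ≥0} {p : C(I, I)} (hp : MemHolder α p) :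
    ∃ K : ℝ, 0 ≤ K ∧ ∀ x y : I, |(p x : ℝ) - p y| ≤ K * |(x : ℝ) - y| ^ (α : ℝ) :=
  memHolder_iff_exists.1 hp

lemma memHolder_transOp {α : ℝ≥0} (hα : 0 < α) {p : C(I, I)} (hp : MemHolder α p) {φ : I → ℂ}
    (hφ : MemHolder α φ) : MemHolder α (transOp p φ) := by
  obtain ⟨K, hK0, hK⟩ := exists_weight_bound hp
  have hc := continuous_of_memHolder hα hφ
  obtain ⟨M, hM⟩ := exists_norm_le_of_continuous hc
  obtain ⟨C, hC0, hC⟩ := memHolder_iff_exists.1 hφ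
  have hM0 := (norm_nonneg _).trans (hM 0)
  have hr := holderRate_pos α
  exact memHolder_iff_exists.2 ⟨_, by positivity, dist_transOp_le hK hc hC hM⟩

lemma memHolder_transOp_iterate {α : ℝ≥0} (hα : 0 < α) {p : C(I, I)} (hp : MemHolder α p)
    {φ : I → ℂ} (hφ : MemHolder α φ) (n : ℕ) : MemHolder α ((transOp p)^[n] φ) := by
  induction n with
  | zero => exact hφ
  | succ n ih =>
    rw [Function.iterate_succ_apply']
    exact memHolder_transOp hα hp ih

lemma transOp_sub (p : C(I, I)) {φ ψ : I → ℂ} (hφ : Continuous φ) (hψ : Continuous ψ) :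
    transOp p (φ - ψ) = transOp p φ - transOp p ψ := by
  funext x
  rw [Pi.sub_apply, transOp_eq_of_continuous p hφ, transOp_eq_of_continuous p hψ,
    transOp_eq_of_continuous p (hφ.sub hψ),
    ← integral_sub (integrable_of_continuous hφ _) (integrable_of_continuous hψ _)]
  rfl

lemma memHolder_sub {α : ℝ≥0} {φ ψ : I → ℂ} (hφ : MemHolder α φ) (hψ : MemHolder α ψ) :
    MemHolder α (φ - ψ) := by
  obtain ⟨C, hC0, hC⟩ := memHolder_iff_exists.1 hφ
  obtain ⟨D, hD0, hD⟩ := memHolder_iff_exists.1 hψ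
  refine memHolder_iff_exists.2 ⟨C + D, by positivity, fun x y => ?_⟩
  rw [add_mul]
  exact (dist_sub_sub_le _ _ _ _).trans (add_le_add (hC x y) (hD x y))

lemma transOp_iterate_sub {α : ℝ≥0} (hα : 0 < α) {p : C(I, I)} (hp : MemHolder α p)
    {φ ψ : I → ℂ} (hφ : MemHolder α φ) (hψ : MemHolder α ψ) (n : ℕ) :
    (transOp p)^[n] (φ - ψ) = (transOp p)^[n] φ - (transOp p)^[n] ψ := by
  induction n with
  | zero => rfl
  | succ n ih =>
    rw [Function.iterate_succ_apply', Function.iterate_succ_apply', Function.iterate_succ_apply',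
      ih, transOp_sub p (continuous_of_memHolder hα (memHolder_transOp_iterate hα hp hφ n))
        (continuous_of_memHolder hα (memHolder_transOp_iterate hα hp hψ n))]

lemma transOp_const (p : C(I, I)) (c : ℂ) : transOp p (fun _ => c) = fun _ => c := by
  funext x
  rw [transOp_eq_of_continuous p continuous_const]
  simp

/-- Hölder seminorms of the iterates decay exponentially when their sup norms do. -/
lemma dist_transOp_iterate_le {α : ℝ≥0} (hα : 0 < α) {p : C(I, I)} (hp : MemHolder α p) {K : ℝ}
    (hK : ∀ x y : I, |(p x : ℝ) - p y| ≤ K * |(x : ℝ) - y| ^ (α : ℝ))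
    {φ : I → ℂ} (hφ : MemHolder α φ) {A ρ D : ℝ} (hρ : 0 ≤ ρ)
    (hb : ∀ n x, ‖(transOp p)^[n] φ x‖ ≤ A * ρ ^ n)
    (h0 : ∀ x y : I, dist (φ x) (φ y) ≤ D * |(x : ℝ) - y| ^ (α : ℝ))
    (hD : holderRate α * D + 2 * K * A ≤ D * ρ) (n : ℕ) (x y : I) :
    dist ((transOp p)^[n] φ x) ((transOp p)^[n] φ y) ≤ D * ρ ^ n * |(x : ℝ) - y| ^ (α : ℝ) := by
  induction n generalizing x y with
  | zero => simpa using h0 x y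
  | succ n ih =>
    rw [Function.iterate_succ_apply']
    refine (dist_transOp_le hK (continuous_of_memHolder hα (memHolder_transOp_iterate hα hp hφ n))
      ih (hb n) x y).trans ?_
    gcongr
    -- `hD` makes `D` large enough to absorb the sup-norm term at every step, so one application of
    -- Doeblin–Fortet gains the factor `ρ`.
    have := mul_le_mul_of_nonneg_right hD (pow_nonneg hρ n)
    rw [pow_succ]
    linarith

/-- An exponential bound in the sup norm, for all Hölder functions, upgrades to
`ConvergesExponentially`. -/
lemma convergesExponentially_of_sup {α : ℝ≥0} (hα : 0 < α) {p : C(I, I)} (hp : MemHolder α p)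
    {L : (I → ℂ) → I → ℂ} {Λ κ ρ : ℝ} (hκ : 0 ≤ κ) (hρ0 : 0 ≤ ρ) (hρ1 : ρ < 1)
    (hΛ : 0 ≤ Λ) (hL : ∀ φ, MemHolder α φ → ∀ x y : I,
      dist (L φ x) (L φ y) ≤ Λ * holderNorm α φ * |(x : ℝ) - y| ^ (α : ℝ))
    (hQL : ∀ φ, MemHolder α φ → transOp p (L φ) = L φ)
    (hsup : ∀ φ, MemHolder α φ → ∀ (n : ℕ) (x : I),
      ‖(transOp p)^[n] φ x - L φ x‖ ≤ κ * ρ ^ n * holderNorm α φ) :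
    ConvergesExponentially α p L := by
  obtain ⟨K, hK0, hK⟩ := exists_weight_bound hp
  have hr0 := holderRate_pos α
  have hr1 := holderRate_lt_one hα
  -- The rate is taken strictly above `holderRate α`: the gap `s - holderRate α` pays for the
  -- sup-norm term in Doeblin–Fortet.
  obtain ⟨s, hs, hs1⟩ : ∃ s, max ρ (holderRate α) < s ∧ s < 1 := exists_between (max_lt hρ1 hr1)
  have hρs : ρ ≤ s := (le_max_left _ _).trans hs.le
  have hrs : 0 < s - holderRate α := sub_pos.2 ((le_max_right _ _).trans_lt hs)
  have hs0 : 0 ≤ s := hρ0.trans hρs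
  -- The part `1 + Λ` bounds the seminorm of `φ - L φ`; the quotient gives `holderRate α * B + 2 * K
  -- * κ ≤ B * s`.
  set B := 1 + Λ + 2 * K * κ / (s - holderRate α)
  have hB : 0 ≤ B := by positivity
  refine ⟨κ + B + 1, s, by positivity, hs0, hs1, fun φ hφ n => ?_⟩
  set N := holderNorm α φ
  have hN : 0 ≤ N := holderNorm_nonneg _ _
  have hLφ : MemHolder α (L φ) := memHolder_iff_exists.2 ⟨_, by positivity, hL φ hφ⟩
  have hψ := memHolder_sub hφ hLφ
  have hfix : ∀ n, (transOp p)^[n] (L φ) = L φ := fun n => Function.iterate_fixed (hQL φ hφ) n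
  have hit : ∀ n, (transOp p)^[n] (φ - L φ) = (transOp p)^[n] φ - L φ := fun n => by
    rw [transOp_iterate_sub hα hp hφ hLφ, hfix]
  have hb : ∀ n x, ‖(transOp p)^[n] (φ - L φ) x‖ ≤ (κ * N) * s ^ n := fun n x => by
    rw [hit]
    refine (hsup φ hφ n x).trans ?_
    have : ρ ^ n ≤ s ^ n := pow_le_pow_left₀ hρ0 hρs n
    nlinarith [mul_le_mul_of_nonneg_left this (mul_nonneg hκ hN)]
  have hd : ∀ n (x y : I), dist ((transOp p)^[n] (φ - L φ) x) ((transOp p)^[n] (φ - L φ) y)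
      ≤ (B * N) * s ^ n * |(x : ℝ) - y| ^ (α : ℝ) := by
    refine fun n => dist_transOp_iterate_le hα hp hK hψ hs0 hb ?_ ?_ n
    · intro x y
      refine (dist_sub_sub_le _ _ _ _).trans ((add_le_add (dist_le_holderNorm hφ x y)
        (hL φ hφ x y)).trans ?_)
      rw [← add_mul]
      gcongr
      have : 0 ≤ 2 * K * κ / (s - holderRate α) := by positivity
      calc N + Λ * N = (1 + Λ) * N := by ring
        _ ≤ B * N := by gcongr; simp only [B]; linarith
    · have h1 : 2 * K * κ ≤ B * (s - holderRate α) := by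
        have : 2 * K * κ = 2 * K * κ / (s - holderRate α) * (s - holderRate α) := by
          field_simp
        rw [this]
        gcongr
        simp only [B]
        linarith
      nlinarith [mul_le_mul_of_nonneg_right h1 hN]
  have hsn : 0 ≤ s ^ n := pow_nonneg hs0 n
  refine ⟨fun x => ?_, ?_, ?_⟩
  · have := hb n x
    rw [hit] at this
    refine this.trans ?_
    nlinarith [mul_nonneg hN hsn, mul_nonneg hB (mul_nonneg hN hsn)]
  · rw [← hit]
    exact memHolder_transOp_iterate hα hp hψ n
  · rw [← hit]
    refine (holderNorm_le (hb n) (by positivity) (hd n)).trans ?_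
    nlinarith [mul_nonneg hN hsn]

/-! ### Lyapunov functions: decay of iterates and support of invariant laws -/

lemma integrable_of_bounded {W : I → ℝ} (hW : Measurable W) (h0 : ∀ x, 0 ≤ W x)
    (h1 : ∀ x, W x ≤ 1) (μ : Measure I) [IsFiniteMeasure μ] : Integrable W μ :=
  Integrable.of_bound hW.aestronglyMeasurable 1
    (Eventually.of_forall fun x => by rw [Real.norm_of_nonneg (h0 x)]; exact h1 x)

lemma integral_transKernel_of_bounded (p : C(I, I)) {W : I → ℝ} (hW : Measurable W)
    (h0 : ∀ x, 0 ≤ W x) (h1 : ∀ x, W x ≤ 1) (x : I) :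
    ∫ y, W y ∂(transKernel p x) = (p x : ℝ) * (∫ t : I, W (homothety t x)) +
      (1 - p x) * (∫ t : I, W (affineMap t x)) :=
  integral_transKernel p hW.stronglyMeasurable
    (fun x => by rw [Real.norm_of_nonneg (h0 x)]; exact h1 x) x

/-- Only the majorant has to be integrable for the norm inequality of Bochner integrals, so no
measurability of `φ` enters. -/
lemma norm_transOp_le_integral (p : C(I, I)) {W : I → ℝ} (hW : Measurable W)
    (h0 : ∀ x, 0 ≤ W x) (h1 : ∀ x, W x ≤ 1) {φ : I → ℂ} {M : ℝ}
    (hφ : ∀ x, ‖φ x‖ ≤ M * W x) (x : I) :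
    ‖transOp p φ x‖ ≤ M * ∫ y, W y ∂(transKernel p x) := by
  have key : ∀ T : I → I, Measurable T → ‖∫ t : I, φ (T t)‖ ≤ M * ∫ t : I, W (T t) := by
    intro T hT
    rw [← integral_const_mul]
    exact norm_integral_le_of_norm_le
      (((integrable_of_bounded (hW.comp hT) (fun x => h0 _) (fun x => h1 _) _)).const_mul M)
      (Eventually.of_forall fun t => hφ (T t))
  rw [integral_transKernel_of_bounded p hW h0 h1]
  refine (norm_add_le _ _).trans ?_
  rw [norm_mul, norm_mul, Complex.norm_real, Complex.norm_real, Real.norm_of_nonneg (p x).2.1,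
    Real.norm_of_nonneg (qWeight p x).2.1, coe_qWeight]
  have hp0 := (p x).2.1
  have hp1 := (p x).2.2
  nlinarith [mul_le_mul_of_nonneg_left (key _ (measurable_homothety x)) hp0,
    mul_le_mul_of_nonneg_left (key _ (measurable_affineMap x)) (sub_nonneg.2 hp1)]

/-- Keeping the factor `W x`, rather than the weaker sup norm, is what lets the bound be iterated:
each step replaces `W` by its mean, at most `ρ W`. -/
lemma norm_transOp_iterate_le_of_lyapunov (p : C(I, I)) {W : I → ℝ} (hW : Measurable W)
    (h0 : ∀ x, 0 ≤ W x) (h1 : ∀ x, W x ≤ 1) {ρ : ℝ} (hρ : 0 ≤ ρ)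
    (hKW : ∀ x, ∫ y, W y ∂(transKernel p x) ≤ ρ * W x) {φ : I → ℂ} {M : ℝ} (hM : 0 ≤ M)
    (hφ : ∀ x, ‖φ x‖ ≤ M * W x) (n : ℕ) (x : I) :
    ‖(transOp p)^[n] φ x‖ ≤ M * ρ ^ n * W x := by
  induction n generalizing x with
  | zero => simpa using hφ x
  | succ n ih =>
    rw [Function.iterate_succ_apply']
    refine (norm_transOp_le_integral p hW h0 h1 ih x).trans ?_
    calc _ ≤ M * ρ ^ n * (ρ * W x) := by gcongr; exact hKW x
      _ = _ := by ring

lemma integral_bind_transKernel {E : Type*} [NormedAddCommGroup E] [NormedSpace ℝ E] (p : C(I, I))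
    (ν : Measure I) [IsProbabilityMeasure ν] {φ : I → E} (hφ : StronglyMeasurable φ) {M : ℝ}
    (hM : ∀ x, ‖φ x‖ ≤ M) :
    ∫ x, φ x ∂(ν.bind (transKernel p)) = ∫ x, ∫ y, φ y ∂(transKernel p x) ∂ν := by
  rw [← Measure.snd_compProd, Measure.snd,
    integral_map measurable_snd.aemeasurable hφ.aestronglyMeasurable,
    Measure.integral_compProd]
  exact Integrable.of_bound (hφ.comp_measurable measurable_snd).aestronglyMeasurable M
    (Eventually.of_forall fun x => hM _)

lemma IsInvariantProb.integral_eq {p : C(I, I)} {ν : Measure I} (hν : IsInvariantProb p ν)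
    {E : Type*} [NormedAddCommGroup E] [NormedSpace ℝ E] {φ : I → E} (hφ : StronglyMeasurable φ)
    {M : ℝ} (hM : ∀ x, ‖φ x‖ ≤ M) :
    ∫ x, ∫ y, φ y ∂(transKernel p x) ∂ν = ∫ x, φ x ∂ν := by
  have := hν.1
  rw [← integral_bind_transKernel p ν hφ hM, hν.2.def]

/-- A strictly contracted Lyapunov function vanishes almost everywhere for every invariant law. -/
lemma IsInvariantProb.ae_eq_zero {p : C(I, I)} {ν : Measure I} (hν : IsInvariantProb p ν)
    {W : I → ℝ} (hW : Measurable W) (h0 : ∀ x, 0 ≤ W x) (h1 : ∀ x, W x ≤ 1) {ρ : ℝ} (hρ : ρ < 1)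
    (hKW : ∀ x, ∫ y, W y ∂(transKernel p x) ≤ ρ * W x) : ∀ᵐ x ∂ν, W x = 0 := by
  have := hν.1
  have hM : ∀ x, ‖W x‖ ≤ 1 := fun x => by rw [Real.norm_of_nonneg (h0 x)]; exact h1 x
  have hi := integrable_of_bounded hW h0 h1 ν
  have e := hν.integral_eq hW.stronglyMeasurable hM
  have hle : ∫ x, ∫ y, W y ∂(transKernel p x) ∂ν ≤ ∫ x, ρ * W x ∂ν :=
    integral_mono_of_nonneg (Eventually.of_forall fun x => integral_nonneg h0)
      (hi.const_mul ρ) (Eventually.of_forall hKW)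
  rw [e, integral_const_mul] at hle
  have hnn : 0 ≤ ∫ x, W x ∂ν := integral_nonneg h0
  have hz : ∫ x, W x ∂ν = 0 := by nlinarith
  exact (integral_eq_zero_iff_of_nonneg h0 hi).1 hz

/-! ### One-step estimates at the end points and the reflection symmetry -/

/-- Whatever the starting point, `t ≤ s` forces `t x ≤ s`, so the homothety alone reaches `[0, s]`
with probability at least `s`. -/
lemma le_transKernel_real_le (p : C(I, I)) (x : I) {s : ℝ} (hs0 : 0 ≤ s) (hs1 : s ≤ 1) :
    p x * s ≤ (transKernel p x).real {y | (y : ℝ) ≤ s} := by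
  have hm : MeasurableSet {y : I | (y : ℝ) ≤ s} := measurableSet_le measurable_subtype_coe (by fun_prop)
  rw [measureReal_def, ← ENNReal.ofReal_le_iff_le_toReal (measure_ne_top _ _), ENNReal.ofReal_mul (p x).2.1]
  change _ ≤ stepLaw p x _
  rw [stepLaw, Measure.add_apply, Measure.smul_apply, smul_eq_mul,
    Measure.map_apply (measurable_homothety x) hm]
  refine le_add_right (mul_le_mul_right ?_ _)
  rw [← unitInterval.volume_Iic ⟨s, hs0, hs1⟩]
  refine measure_mono fun t ht => ?_
  have : (t : ℝ) ≤ s := ht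
  change (t : ℝ) * x ≤ s
  nlinarith [t.2.1, x.2.2]

/-- The weight of the chain reflected by `x ↦ 1 - x`. -/
def reflect (p : C(I, I)) : C(I, I) :=
  ⟨fun x => σ (p (σ x)), continuous_symm.comp (p.continuous.comp continuous_symm)⟩

lemma reflect_apply (p : C(I, I)) (x : I) : reflect p x = σ (p (σ x)) := rfl

lemma reflect_reflect (p : C(I, I)) : reflect (reflect p) = p := by
  ext x
  simp [reflect_apply]

lemma homothety_symm (t x : I) : homothety t (σ x) = σ (affineMap t x) := by
  ext
  simp only [coe_homothety, coe_symm_eq, coe_affineMap]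
  ring

lemma affineMap_symm (t x : I) : affineMap t (σ x) = σ (homothety t x) := by
  ext
  simp only [coe_homothety, coe_symm_eq, coe_affineMap]
  ring

/-- Conjugation by `σ` exchanges homotheties with affine maps and `p` with `q`. Estimates at `1` are
thus inherited from those at `0`. -/
lemma transKernel_reflect (p : C(I, I)) (x : I) :
    transKernel (reflect p) (σ x) = (transKernel p x).map σ := by
  change stepLaw _ _ = (stepLaw p x).map σ
  simp only [stepLaw, homothety_symm, affineMap_symm]
  rw [Measure.map_add _ _ measurable_symm, Measure.map_smul, Measure.map_smul,
    Measure.map_map measurable_symm (measurable_homothety x),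
    Measure.map_map measurable_symm (measurable_affineMap x), add_comm]
  simp only [qWeight, reflect_apply, symm_symm, Function.comp_def]

lemma integral_transKernel_reflect (p : C(I, I)) (x : I) (W : I → ℝ) :
    ∫ y, W (σ y) ∂(transKernel (reflect p) (σ x)) = ∫ y, W y ∂(transKernel p x) := by
  rw [transKernel_reflect, ← coe_symmMeasurableEquiv, integral_map_equiv]
  simp

lemma le_transKernel_real_ge (p : C(I, I)) (x : I) {s : ℝ} (hs0 : 0 ≤ s) (hs1 : s ≤ 1) :
    (1 - p x) * s ≤ (transKernel p x).real {y | 1 - s ≤ (y : ℝ)} := by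
  have hm : MeasurableSet {y : I | (y : ℝ) ≤ s} := measurableSet_le measurable_subtype_coe (by fun_prop)
  have h := le_transKernel_real_le (reflect p) (σ x) hs0 hs1
  rw [transKernel_reflect, measureReal_def, Measure.map_apply measurable_symm hm] at h
  simp only [reflect_apply, symm_symm, coe_symm_eq] at h
  refine h.trans (le_of_eq ?_)
  rw [measureReal_def]
  congr 2
  ext y
  simp only [Set.mem_preimage, Set.mem_ofPred_eq, coe_symm_eq]
  constructor <;> intro h <;> linarith

/-- An upper bound for the integral of a function that drops near both end points. -/
lemma integral_transKernel_le_of_drop (p : C(I, I)) {W : I → ℝ} (hW : Measurable W)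
    (h0 : ∀ x, 0 ≤ W x) (h1 : ∀ x, W x ≤ 1) {a b s s' : ℝ} (ha : 0 ≤ a) (hb : 0 ≤ b)
    (hs0 : 0 ≤ s) (hs1 : s ≤ 1 / 4) (hs0' : 0 ≤ s') (hs1' : s' ≤ 1 / 4)
    (hA : ∀ y : I, (y : ℝ) ≤ s → W y ≤ 1 - a) (hB : ∀ y : I, 1 - s' ≤ (y : ℝ) → W y ≤ 1 - b)
    (x : I) :
    ∫ y, W y ∂(transKernel p x) ≤ 1 - a * (p x * s) - b * ((1 - p x) * s') := by
  have hmA : MeasurableSet {y : I | (y : ℝ) ≤ s} :=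
    measurableSet_le measurable_subtype_coe (by fun_prop)
  have hmB : MeasurableSet {y : I | 1 - s' ≤ (y : ℝ)} :=
    measurableSet_le (by fun_prop) measurable_subtype_coe
  set μ := transKernel p x
  set A := {y : I | (y : ℝ) ≤ s}
  set B := {y : I | 1 - s' ≤ (y : ℝ)}
  have iA : Integrable (A.indicator fun _ => a) μ := (integrable_const a).indicator hmA
  have iB : Integrable (B.indicator fun _ => b) μ := (integrable_const b).indicator hmB
  have iA' : Integrable (fun y => 1 - A.indicator (fun _ => a) y) μ := (integrable_const 1).sub iA
  have hle : ∫ y, W y ∂μ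
      ≤ ∫ y, (1 - A.indicator (fun _ => a) y - B.indicator (fun _ => b) y) ∂μ := by
    refine integral_mono (integrable_of_bounded hW h0 h1 μ) (iA'.sub iB) fun y => ?_
    change W y ≤ 1 - A.indicator (fun _ => a) y - B.indicator (fun _ => b) y
    by_cases hyA : y ∈ A <;> by_cases hyB : y ∈ B
    -- Impossible: thresholds at most `1/4` keep the two end zones disjoint.
    · have h3 : (y : ℝ) ≤ s := hyA
      have h4 : 1 - s' ≤ (y : ℝ) := hyB
      linarith
    · rw [Set.indicator_of_mem hyA, Set.indicator_of_notMem hyB, sub_zero]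
      exact hA y hyA
    · rw [Set.indicator_of_notMem hyA, Set.indicator_of_mem hyB, sub_zero]
      exact hB y hyB
    · rw [Set.indicator_of_notMem hyA, Set.indicator_of_notMem hyB, sub_zero, sub_zero]
      exact h1 y
  refine hle.trans ?_
  rw [integral_sub iA' iB, integral_sub (integrable_const 1) iA,
    integral_indicator_const _ hmA, integral_indicator_const _ hmB]
  simp only [integral_const, probReal_univ, smul_eq_mul, mul_one]
  have hA' := mul_le_mul_of_nonneg_left (le_transKernel_real_le p x hs0 (by linarith)) ha
  have hB' := mul_le_mul_of_nonneg_left (le_transKernel_real_ge p x hs0' (by linarith)) hb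
  linarith

/-- Contraction near an absorbing end point. -/
lemma integral_transKernel_le_near_zero {α : ℝ≥0} {p : C(I, I)} {K : ℝ}
    (hK : ∀ x y : I, |(p x : ℝ) - p y| ≤ K * |(x : ℝ) - y| ^ (α : ℝ)) (hp0 : p 0 = 1)
    {δ : ℝ} (hδ : 0 < δ) (hδK : K * δ ^ (α : ℝ) ≤ (1 - holderRate α) / 2)
    {W : I → ℝ} (hW : Measurable W) (h0 : ∀ x, 0 ≤ W x) (h1 : ∀ x, W x ≤ 1)
    (hWδ : ∀ y : I, W y ≤ ((y : ℝ) / δ) ^ (α : ℝ)) (x : I) :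
    ∫ y, W y ∂(transKernel p x) ≤ (1 + holderRate α) / 2 * ((x : ℝ) / δ) ^ (α : ℝ) := by
  rw [integral_transKernel_of_bounded p hW h0 h1]
  set U := ((x : ℝ) / δ) ^ (α : ℝ)
  have hU : 0 ≤ U := Real.rpow_nonneg (div_nonneg x.2.1 hδ.le) _
  have e1 : ∫ t : I, W (homothety t x) ≤ holderRate α * U := by
    have hc : Continuous fun t : I => (t : ℝ) ^ (α : ℝ) * U :=
      (continuous_subtype_val.rpow_const fun _ => Or.inr α.2).mul continuous_const
    calc ∫ t : I, W (homothety t x) ≤ ∫ t : I, (t : ℝ) ^ (α : ℝ) * U := by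
          refine integral_mono (integrable_of_bounded (hW.comp (measurable_homothety x))
            (fun _ => h0 _) (fun _ => h1 _) _) (integrable_of_continuous hc _) fun t => ?_
          refine (hWδ _).trans (le_of_eq ?_)
          rw [coe_homothety, mul_div_assoc, Real.mul_rpow t.2.1 (div_nonneg x.2.1 hδ.le)]
      _ = _ := by rw [integral_mul_const, integral_rpow_unitInterval, holderRate]
  have e2 : ∫ t : I, W (affineMap t x) ≤ 1 := by
    calc ∫ t : I, W (affineMap t x) ≤ ∫ t : I, (1 : ℝ) :=
          integral_mono (integrable_of_bounded (hW.comp (measurable_affineMap x))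
            (fun _ => h0 _) (fun _ => h1 _) _) (integrable_const _) fun t => h1 _
      _ = 1 := by simp
  -- The move away from `0` may carry `W` up to `1`, but as `q 0 = 0` its probability is of order
  -- `x^α`, hence a small multiple of `U`.
  have e3 : 1 - (p x : ℝ) ≤ K * δ ^ (α : ℝ) * U := by
    have := hK 0 x
    rw [hp0] at this
    have e : (x : ℝ) ^ (α : ℝ) = δ ^ (α : ℝ) * U := by
      rw [← Real.mul_rpow hδ.le (div_nonneg x.2.1 hδ.le), mul_div_cancel₀ _ hδ.ne']
    simp only [Set.Icc.coe_one, Set.Icc.coe_zero, zero_sub, abs_neg] at this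
    rw [abs_of_nonneg x.2.1, e, ← mul_assoc] at this
    exact (le_abs_self _).trans this
  have hpx0 := (p x).2.1
  have hpx1 := (p x).2.2
  have hr := holderRate_pos α
  -- With `r = holderRate α`, the two moves give at most `r U + K δ^α U ≤ (r + (1 - r)/2) U`.
  nlinarith [mul_le_mul_of_nonneg_left e1 hpx0, mul_le_mul_of_nonneg_left e2 (sub_nonneg.2 hpx1),
    mul_le_mul_of_nonneg_right hδK hU, mul_nonneg hr.le hU,
    mul_nonneg (mul_nonneg hr.le hU) (sub_nonneg.2 hpx1)]

/-! ### Construction of the Lyapunov functions -/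

lemma exists_small_rpow {α : ℝ≥0} (hα : 0 < α) (K : ℝ) {ε : ℝ} (hε : 0 < ε) :
    ∃ δ : ℝ, 0 < δ ∧ δ ≤ 1 / 4 ∧ K * δ ^ (α : ℝ) ≤ ε := by
  have hc : Tendsto (fun δ : ℝ => K * δ ^ (α : ℝ)) (𝓝[>] 0) (𝓝 (K * 0 ^ (α : ℝ))) :=
    ((continuous_const.mul (Real.continuous_rpow_const α.2)).tendsto 0).mono_left
      nhdsWithin_le_nhds
  rw [Real.zero_rpow (NNReal.coe_ne_zero.2 hα.ne'), mul_zero] at hc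
  obtain ⟨δ, h1, h2⟩ := ((hc.eventually (gt_mem_nhds hε)).and
    (Ioo_mem_nhdsGT (by norm_num : (0 : ℝ) < 1 / 4))).exists
  exact ⟨δ, h2.1, h2.2.le, h1.le⟩

/-- The Lyapunov profile at the end point `0`. -/
def endProfile (α : ℝ≥0) (δ : ℝ) (x : I) : ℝ := min 1 (((x : ℝ) / δ) ^ (α : ℝ))

lemma continuous_endProfile (α : ℝ≥0) (δ : ℝ) : Continuous (endProfile α δ) := by
  refine continuous_const.min ?_
  exact (continuous_subtype_val.div_const δ).rpow_const fun _ => Or.inr α.2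

lemma endProfile_nonneg (α : ℝ≥0) {δ : ℝ} (hδ : 0 < δ) (x : I) : 0 ≤ endProfile α δ x :=
  le_min zero_le_one (Real.rpow_nonneg (div_nonneg x.2.1 hδ.le) _)

lemma endProfile_le_one (α : ℝ≥0) (δ : ℝ) (x : I) : endProfile α δ x ≤ 1 := min_le_left _ _

lemma endProfile_of_le {α : ℝ≥0} {δ : ℝ} (hδ : 0 < δ) {x : I} (h : (x : ℝ) ≤ δ) :
    endProfile α δ x = ((x : ℝ) / δ) ^ (α : ℝ) :=
  min_eq_right (Real.rpow_le_one (div_nonneg x.2.1 hδ.le) ((div_le_one hδ).2 h) α.2)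

lemma endProfile_of_ge {α : ℝ≥0} {δ : ℝ} (hδ : 0 < δ) {x : I} (h : δ ≤ (x : ℝ)) :
    endProfile α δ x = 1 :=
  min_eq_left (Real.one_le_rpow ((one_le_div hδ).2 h) α.2)

lemma rpow_le_endProfile (α : ℝ≥0) {δ : ℝ} (hδ : 0 < δ) (hδ1 : δ ≤ 1) (x : I) :
    (x : ℝ) ^ (α : ℝ) ≤ endProfile α δ x :=
  le_min (Real.rpow_le_one x.2.1 x.2.2 α.2) (Real.rpow_le_rpow x.2.1
    (le_div_self x.2.1 hδ hδ1) α.2)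

lemma endProfile_le_half {α : ℝ≥0} {δ : ℝ} (hδ : 0 < δ) {x : I} (h : (x : ℝ) ≤ δ / 2) :
    endProfile α δ x ≤ 1 - (1 - (1 / 2 : ℝ) ^ (α : ℝ)) := by
  rw [sub_sub_cancel]
  refine (min_le_right _ _).trans (Real.rpow_le_rpow (div_nonneg x.2.1 hδ.le) ?_ α.2)
  rw [div_le_iff₀ hδ]
  linarith

lemma half_rpow_lt_one {α : ℝ≥0} (hα : 0 < α) : (1 / 2 : ℝ) ^ (α : ℝ) < 1 :=
  Real.rpow_lt_one (by norm_num) (by norm_num) hα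

/-- The profile at `0` alone does not decrease in mean where `p` vanishes, since the chain may then
stay where the profile is `1`. Lowering it by `γ` near `1` repairs this: in the middle, moves to the
left reach the zone near `0` and moves to the right reach the lowered zone. Near `1` itself `p` is
bounded below, and the jumps towards `0` outweigh the correction. The correction makes `W`
discontinuous, and is at most half the profile there, whence the factor `2`. -/
lemma exists_lyapunov_zero {α : ℝ≥0} (hα : 0 < α) {p : C(I, I)} (hp : MemHolder α p)
    (hp0 : p 0 = 1) (hp1 : qWeight p 1 < 1) :
    ∃ (W : I → ℝ) (ρ : ℝ), Measurable W ∧ (∀ x, 0 ≤ W x) ∧ (∀ x, W x ≤ 1) ∧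
      (∀ x : I, (x : ℝ) ^ (α : ℝ) ≤ 2 * W x) ∧ 0 ≤ ρ ∧ ρ < 1 ∧
      ∀ x, ∫ y, W y ∂(transKernel p x) ≤ ρ * W x := by
  obtain ⟨K, hK0, hK⟩ := exists_weight_bound hp
  have hr1 := holderRate_lt_one hα
  have hr0 := holderRate_pos α
  obtain ⟨δ, hδ, hδ4, hδK⟩ := exists_small_rpow hα K (half_pos (sub_pos.2 hr1))
  have hp1' : 0 < (p 1 : ℝ) := by
    have : (qWeight p 1 : ℝ) < 1 := hp1
    rw [coe_qWeight] at this
    linarith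
  obtain ⟨s, hs, hs4, hsK⟩ := exists_small_rpow hα K (half_pos hp1')
  set c := (p 1 : ℝ) / 2
  have hc : 0 < c := half_pos hp1'
  have hc1 : c ≤ 1 / 2 := by have := (p 1).2.2; simp only [c]; linarith
  have hcp : ∀ x : I, 1 - s ≤ (x : ℝ) → c ≤ p x := by
    intro x hx
    have h := hK 1 x
    have h2 : K * |((1 : I) : ℝ) - x| ^ (α : ℝ) ≤ K * s ^ (α : ℝ) := by
      refine mul_le_mul_of_nonneg_left (Real.rpow_le_rpow (abs_nonneg _) ?_ α.2) hK0
      simp only [Set.Icc.coe_one]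
      rw [abs_of_nonneg (by linarith [x.2.2])]
      linarith
    have := (le_abs_self _).trans (h.trans (h2.trans hsK))
    simp only [c] at this ⊢
    linarith
  set η := 1 - (1 / 2 : ℝ) ^ (α : ℝ) with hη_def
  have hη : 0 < η := sub_pos.2 (half_rpow_lt_one hα)
  have hη1 : η ≤ 1 := by
    have : (0 : ℝ) ≤ (1 / 2 : ℝ) ^ (α : ℝ) := by positivity
    linarith
  -- Half of the drop `η * c * (δ / 2)` guaranteed near `1`, so that the mean there is at most `1 -
  -- 2γ ≤ (1 - γ)^2`.
  set γ := η * c * δ / 4 with hγ_def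
  have hγ : 0 < γ := by positivity
  have hγ1 : γ ≤ 1 / 2 := by
    have : η * c ≤ 1 := mul_le_one₀ hη1 hc.le (by linarith)
    have : η * c * δ ≤ 1 := mul_le_one₀ this hδ.le (by linarith)
    linarith
  have hmB : MeasurableSet {y : I | 1 - s ≤ (y : ℝ)} :=
    measurableSet_le (by fun_prop) measurable_subtype_coe
  set W : I → ℝ := fun y => endProfile α δ y - {y : I | 1 - s ≤ (y : ℝ)}.indicator (fun _ => γ) y
  have hWm : Measurable W := (continuous_endProfile α δ).measurable.sub
    (measurable_const.indicator hmB)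
  have hWB : ∀ y : I, 1 - s ≤ (y : ℝ) → W y = 1 - γ := fun y hy => by
    simp only [W, endProfile_of_ge hδ (show δ ≤ (y : ℝ) by linarith)]
    rw [Set.indicator_of_mem (show y ∈ {y : I | 1 - s ≤ (y : ℝ)} from hy)]
  have hWA : ∀ y : I, (y : ℝ) < 1 - s → W y = endProfile α δ y := fun y hy => by
    simp only [W]
    rw [Set.indicator_of_notMem (show y ∉ {y : I | 1 - s ≤ (y : ℝ)} from not_le.2 hy), sub_zero]
  have hWE : ∀ y, W y ≤ endProfile α δ y := fun y =>
    sub_le_self _ (Set.indicator_nonneg (fun _ _ => hγ.le) y)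
  have hW1 : ∀ y, W y ≤ 1 := fun y => (hWE y).trans (endProfile_le_one _ _ _)
  have hWhalf : ∀ y, endProfile α δ y ≤ 2 * W y := fun y => by
    rcases lt_or_ge (y : ℝ) (1 - s) with hy | hy
    · rw [hWA y hy]
      linarith [endProfile_nonneg α hδ y]
    · rw [hWB y hy]
      linarith [endProfile_le_one α δ y]
  have hW0 : ∀ y, 0 ≤ W y := fun y => by linarith [hWhalf y, endProfile_nonneg α hδ y]
  have hdrop := integral_transKernel_le_of_drop p hWm hW0 hW1 hη.le hγ.le (half_pos hδ).le
    (by linarith) hs.le hs4 (fun y hy => (hWE y).trans (endProfile_le_half hδ hy))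
    (fun y hy => (hWB y hy).le)
  -- In the middle the drop is the average, with weights `p` and `q`, of `η * (δ / 2)` and `γ * s`,
  -- hence at least their minimum.
  set θ := min (η * (δ / 2)) (γ * s)
  have hθ : 0 < θ := by positivity
  set ρ := max ((1 + holderRate α) / 2) (max (1 - θ) (1 - γ))
  have hρ0 : (1 + holderRate α) / 2 ≤ ρ := le_max_left _ _
  have hρ1 : 1 - θ ≤ ρ := (le_max_left _ _).trans (le_max_right _ _)
  have hρ2 : 1 - γ ≤ ρ := (le_max_right _ _).trans (le_max_right _ _)
  refine ⟨W, ρ, hWm, hW0, hW1, fun x => (rpow_le_endProfile α hδ (by linarith) x).trans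
    (hWhalf x), by linarith, max_lt (by linarith) (max_lt (by linarith) (by linarith)),
    fun x => ?_⟩
  have hpx0 := (p x).2.1
  have hpx1 := (p x).2.2
  rcases le_or_gt (x : ℝ) δ with hx | hx
  · refine (integral_transKernel_le_near_zero hK hp0 hδ hδK hWm hW0 hW1
      (fun y => (hWE y).trans (min_le_right _ _)) x).trans ?_
    rw [hWA x (by linarith), endProfile_of_le hδ hx]
    exact mul_le_mul_of_nonneg_right hρ0 (Real.rpow_nonneg (div_nonneg x.2.1 hδ.le) _)
  · refine (hdrop x).trans ?_
    rcases lt_or_ge (x : ℝ) (1 - s) with hy | hy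
    · rw [hWA x hy, endProfile_of_ge hδ hx.le]
      have t1 : θ ≤ η * (δ / 2) := min_le_left _ _
      have t2 : θ ≤ γ * s := min_le_right _ _
      nlinarith [mul_le_mul_of_nonneg_left t1 hpx0,
        mul_le_mul_of_nonneg_left t2 (sub_nonneg.2 hpx1)]
    · rw [hWB x hy]
      have t1 : η * (c * (δ / 2)) ≤ η * (p x * (δ / 2)) := by
        gcongr
        exact hcp x hy
      have t2 : 0 ≤ γ * ((1 - p x) * s) :=
        mul_nonneg hγ.le (mul_nonneg (sub_nonneg.2 hpx1) hs.le)
      nlinarith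

/-- The minimum of the two end profiles is low at both ends, so both moves can produce a drop and no
correction is needed: in the middle the weights `p` and `q` add up to a drop of `η * (δ / 2)`. -/
lemma exists_lyapunov_both {α : ℝ≥0} (hα : 0 < α) {p : C(I, I)} (hp : MemHolder α p)
    (hp0 : p 0 = 1) (hp1 : qWeight p 1 = 1) :
    ∃ (V : I → ℝ) (ρ : ℝ), Continuous V ∧ (∀ x, 0 ≤ V x) ∧ (∀ x, V x ≤ 1) ∧
      (∀ x : I, min ((x : ℝ) ^ (α : ℝ)) ((1 - x : ℝ) ^ (α : ℝ)) ≤ V x) ∧ 0 ≤ ρ ∧ ρ < 1 ∧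
      ∀ x, ∫ y, V y ∂(transKernel p x) ≤ ρ * V x := by
  obtain ⟨K, hK0, hK⟩ := exists_weight_bound hp
  have hr1 := holderRate_lt_one hα
  have hr0 := holderRate_pos α
  obtain ⟨δ, hδ, hδ4, hδK⟩ := exists_small_rpow hα K (half_pos (sub_pos.2 hr1))
  set η := 1 - (1 / 2 : ℝ) ^ (α : ℝ) with hη_def
  have hη : 0 < η := sub_pos.2 (half_rpow_lt_one hα)
  have hη1 : η ≤ 1 := by
    have : (0 : ℝ) ≤ (1 / 2 : ℝ) ^ (α : ℝ) := by positivity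
    linarith
  set V : I → ℝ := fun y => min (endProfile α δ y) (endProfile α δ (σ y))
  have hVc : Continuous V :=
    (continuous_endProfile α δ).min ((continuous_endProfile α δ).comp continuous_symm)
  have hV0 : ∀ y, 0 ≤ V y := fun y => le_min (endProfile_nonneg α hδ _) (endProfile_nonneg α hδ _)
  have hV1 : ∀ y, V y ≤ 1 := fun y => (min_le_left _ _).trans (endProfile_le_one _ _ _)
  have hVσ : ∀ y, V (σ y) = V y := fun y => by simp only [V, symm_symm, min_comm]
  have hdrop := integral_transKernel_le_of_drop p hVc.measurable hV0 hV1 hη.le hη.le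
    (half_pos hδ).le (by linarith) (half_pos hδ).le (by linarith)
    (fun y hy => (min_le_left _ _).trans (endProfile_le_half hδ hy))
    (fun y hy => (min_le_right _ _).trans (endProfile_le_half hδ (by
      rw [coe_symm_eq]; linarith)))
  set ρ := max ((1 + holderRate α) / 2) (1 - η * (δ / 2))
  have hρ0 : (1 + holderRate α) / 2 ≤ ρ := le_max_left _ _
  have hρ1 : 1 - η * (δ / 2) ≤ ρ := le_max_right _ _
  -- Quantified over the weight so as to apply to `reflect p` too, `V` being symmetric under `σ`.
  have hend : ∀ (p : C(I, I)), (∀ x y : I, |(p x : ℝ) - p y| ≤ K * |(x : ℝ) - y| ^ (α : ℝ)) →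
      p 0 = 1 → ∀ x : I, (x : ℝ) ≤ δ → ∫ y, V y ∂(transKernel p x) ≤ ρ * V x := by
    intro p hK hp0 x hx
    refine (integral_transKernel_le_near_zero hK hp0 hδ hδK hVc.measurable hV0 hV1
      (fun y => (min_le_left _ _).trans (min_le_right _ _)) x).trans ?_
    have : V x = ((x : ℝ) / δ) ^ (α : ℝ) := by
      simp only [V]
      rw [endProfile_of_ge hδ (x := σ x) (by rw [coe_symm_eq]; linarith), endProfile_of_le hδ hx]
      exact min_eq_left (Real.rpow_le_one (div_nonneg x.2.1 hδ.le) ((div_le_one hδ).2 hx) α.2)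
    rw [this]
    exact mul_le_mul_of_nonneg_right hρ0 (Real.rpow_nonneg (div_nonneg x.2.1 hδ.le) _)
  refine ⟨V, ρ, hVc, hV0, hV1, fun x => min_le_min (rpow_le_endProfile α hδ (by linarith) x) ?_,
    by linarith, max_lt (by linarith) (by have := mul_pos hη hδ; linarith), fun x => ?_⟩
  · simpa [coe_symm_eq] using rpow_le_endProfile α hδ (by linarith) (σ x)
  have hpx0 := (p x).2.1
  have hpx1 := (p x).2.2
  rcases le_or_gt (x : ℝ) δ with hx | hx
  · exact hend p hK hp0 x hx
  rcases le_or_gt (1 - (x : ℝ)) δ with hx' | hx'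
  · have := hend (reflect p) (fun x y => ?_) ?_ (σ x) (by rw [coe_symm_eq]; exact hx')
    · rw [hVσ, ← integral_transKernel_reflect, reflect_reflect, symm_symm] at this
      simpa only [hVσ] using this
    · have := hK (σ y) (σ x)
      simp only [reflect_apply, coe_symm_eq, sub_sub_sub_cancel_left] at this ⊢
      exact this
    · simpa [reflect_apply, qWeight] using hp1
  · refine (hdrop x).trans ?_
    have : V x = 1 := by
      simp only [V]
      rw [endProfile_of_ge hδ hx.le, endProfile_of_ge hδ (x := σ x) (by
        rw [coe_symm_eq]; exact hx'.le), min_self]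
    rw [this]
    nlinarith

/-! ### Absorbing end points: Dirac masses and the case of a single one -/

lemma transKernel_zero {p : C(I, I)} (hp0 : p 0 = 1) : transKernel p 0 = Measure.dirac 0 := by
  change stepLaw p 0 = _
  have h : (fun t : I => homothety t 0) = fun _ => 0 := by
    funext t
    ext
    simp [coe_homothety]
  rw [stepLaw, h, Measure.map_const]
  simp [qWeight, hp0]

lemma transKernel_one {p : C(I, I)} (hp1 : qWeight p 1 = 1) :
    transKernel p 1 = Measure.dirac 1 := by
  change stepLaw p 1 = _
  have h : (fun t : I => affineMap t 1) = fun _ => 1 := by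
    funext t
    ext
    simp [coe_affineMap]
  have hp : p 1 = 0 := by
    have := congrArg σ hp1
    rwa [qWeight, symm_symm, symm_one] at this
  rw [stepLaw, h, Measure.map_const, hp1]
  simp [hp]

lemma transOp_absorbing {p : C(I, I)} {e : I} (he : transKernel p e = Measure.dirac e) {φ : I → ℂ}
    (hφ : Continuous φ) : transOp p φ e = φ e := by
  rw [transOp_eq_of_continuous p hφ, he, integral_dirac]

lemma isInvariantProb_dirac {p : C(I, I)} {e : I} (he : transKernel p e = Measure.dirac e) :
    IsInvariantProb p (Measure.dirac e) :=
  ⟨inferInstance, by rw [Kernel.Invariant, Measure.dirac_bind (transKernel p).measurable, he]⟩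

lemma eq_dirac_of_ae_eq {ν : Measure I} [IsProbabilityMeasure ν] {e : I} (h : ∀ᵐ x ∂ν, x = e) :
    ν = Measure.dirac e := by
  have h2 : (id : I → I) =ᵐ[ν] fun _ => e := h
  rw [← Measure.map_id (μ := ν), Measure.map_congr h2, Measure.map_const]
  simp

lemma memHolder_reflect {α : ℝ≥0} {p : C(I, I)} (hp : MemHolder α p) :
    MemHolder α (reflect p) := by
  obtain ⟨K, hK0, hK⟩ := exists_weight_bound hp
  refine memHolder_iff_exists.2 ⟨K, hK0, fun x y => ?_⟩
  have := hK (σ y) (σ x)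
  rw [Subtype.dist_eq, Real.dist_eq]
  simp only [reflect_apply, coe_symm_eq, sub_sub_sub_cancel_left] at this ⊢
  exact this

lemma exists_lyapunov_one {α : ℝ≥0} (hα : 0 < α) {p : C(I, I)} (hp : MemHolder α p)
    (hp0 : p 0 < 1) (hp1 : qWeight p 1 = 1) :
    ∃ (W : I → ℝ) (ρ : ℝ), Measurable W ∧ (∀ x, 0 ≤ W x) ∧ (∀ x, W x ≤ 1) ∧
      (∀ x : I, (1 - x : ℝ) ^ (α : ℝ) ≤ 2 * W x) ∧ 0 ≤ ρ ∧ ρ < 1 ∧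
      ∀ x, ∫ y, W y ∂(transKernel p x) ≤ ρ * W x := by
  obtain ⟨W, ρ, hW, h0, h1, hx, hρ0, hρ1, hKW⟩ :=
    exists_lyapunov_zero hα (memHolder_reflect hp) (by simpa [reflect_apply, qWeight] using hp1)
      (by simpa [reflect_apply, qWeight] using hp0)
  refine ⟨fun x => W (σ x), ρ, hW.comp measurable_symm, fun x => h0 _, fun x => h1 _, fun x => ?_,
    hρ0, hρ1, fun x => ?_⟩
  · simpa [coe_symm_eq] using hx (σ x)
  · have := hKW (σ x)
    rwa [← integral_transKernel_reflect, reflect_reflect, symm_symm] at this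

/-- The case of exactly one absorbing end point, given a Lyapunov function. -/
lemma absorbing_of_lyapunov {α : ℝ≥0} (hα : 0 < α) {p : C(I, I)} (hp : MemHolder α p) {e : I}
    (he : transKernel p e = Measure.dirac e) {W : I → ℝ} {ρ : ℝ} (hW : Measurable W)
    (h0 : ∀ x, 0 ≤ W x) (h1 : ∀ x, W x ≤ 1)
    (hx : ∀ x : I, |(x : ℝ) - e| ^ (α : ℝ) ≤ 2 * W x) (hρ0 : 0 ≤ ρ) (hρ1 : ρ < 1)
    (hKW : ∀ x, ∫ y, W y ∂(transKernel p x) ≤ ρ * W x) :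
    (∀ ν : Measure I, IsInvariantProb p ν ↔ ν = Measure.dirac e) ∧
      ConvergesExponentially α p (fun φ _ => φ e) := by
  refine ⟨fun ν => ⟨fun hν => ?_, fun h => h ▸ isInvariantProb_dirac he⟩, ?_⟩
  · have := hν.1
    refine eq_dirac_of_ae_eq ?_
    filter_upwards [hν.ae_eq_zero hW h0 h1 hρ1 hKW] with x hWx
    have h2 := hx x
    rw [hWx, mul_zero] at h2
    have h3 : |(x : ℝ) - e| ^ (α : ℝ) = 0 := h2.antisymm (Real.rpow_nonneg (abs_nonneg _) _)
    rw [Real.rpow_eq_zero (abs_nonneg _) (NNReal.coe_ne_zero.2 hα.ne'), abs_eq_zero] at h3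
    exact Subtype.ext (sub_eq_zero.1 h3)
  · refine convergesExponentially_of_sup hα hp (Λ := 0) (κ := 2) zero_le_two hρ0 hρ1 le_rfl ?_ ?_ ?_
    · intro φ _ x y
      simp
    · intro φ _
      exact transOp_const p _
    · intro φ hφ n x
      have hN := holderNorm_nonneg α φ
      have hc : MemHolder α (fun _ : I => φ e) := memHolder_const
      have e1 : (transOp p)^[n] φ x - φ e = (transOp p)^[n] (φ - fun _ => φ e) x := by
        rw [transOp_iterate_sub hα hp hφ hc, Function.iterate_fixed (transOp_const p (φ e))]
        rfl
      rw [e1]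
      have hb : ∀ x, ‖(φ - fun _ : I => φ e) x‖ ≤ (2 * holderNorm α φ) * W x := fun x => by
        have := dist_le_holderNorm hφ x e
        rw [dist_eq_norm] at this
        refine this.trans ?_
        nlinarith [mul_le_mul_of_nonneg_left (hx x) hN]
      refine (norm_transOp_iterate_le_of_lyapunov p hW h0 h1 hρ0 hKW (by positivity) hb n x).trans ?_
      calc _ ≤ 2 * holderNorm α φ * ρ ^ n * 1 := by gcongr; exact h1 x
        _ = _ := by ring

lemma absorbing_zero {α : ℝ≥0} (hα : 0 < α) {p : C(I, I)} (hp : MemHolder α p)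
    (hp0 : p 0 = 1) (hp1 : qWeight p 1 < 1) :
    (∀ ν : Measure I, IsInvariantProb p ν ↔ ν = Measure.dirac 0) ∧
      ConvergesExponentially α p (fun φ _ => φ 0) := by
  obtain ⟨W, ρ, hW, h0, h1, hx, hρ0, hρ1, hKW⟩ := exists_lyapunov_zero hα hp hp0 hp1
  refine absorbing_of_lyapunov hα hp (transKernel_zero hp0) hW h0 h1 (fun x => ?_) hρ0 hρ1 hKW
  simpa [abs_of_nonneg x.2.1] using hx x

lemma absorbing_one {α : ℝ≥0} (hα : 0 < α) {p : C(I, I)} (hp : MemHolder α p)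
    (hp0 : p 0 < 1) (hp1 : qWeight p 1 = 1) :
    (∀ ν : Measure I, IsInvariantProb p ν ↔ ν = Measure.dirac 1) ∧
      ConvergesExponentially α p (fun φ _ => φ 1) := by
  obtain ⟨W, ρ, hW, h0, h1, hx, hρ0, hρ1, hKW⟩ := exists_lyapunov_one hα hp hp0 hp1
  refine absorbing_of_lyapunov hα hp (transKernel_one hp1) hW h0 h1 (fun x => ?_) hρ0 hρ1 hKW
  have : |(x : ℝ) - (1 : I)| = 1 - x := by
    rw [abs_sub_comm, Set.Icc.coe_one, abs_of_nonneg (sub_nonneg.2 x.2.2)]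
  rw [this]
  exact hx x

/-! ### Two absorbing end points -/

lemma isInvariantProb_convexComb {p : C(I, I)} (hp0 : p 0 = 1) (hp1 : qWeight p 1 = 1) {s : ℝ}
    (hs0 : 0 ≤ s) (hs1 : s ≤ 1) :
    IsInvariantProb p (ENNReal.ofReal (1 - s) • Measure.dirac 0 +
      ENNReal.ofReal s • Measure.dirac 1) := by
  refine ⟨⟨?_⟩, ?_⟩
  · simp only [Measure.add_apply, Measure.smul_apply, measure_univ, smul_eq_mul, mul_one]
    rw [← ENNReal.ofReal_add (by linarith) hs0]
    simp
  · rw [Kernel.Invariant]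
    ext A hA
    rw [Measure.bind_apply hA (transKernel p).aemeasurable, lintegral_add_measure,
      lintegral_smul_measure, lintegral_smul_measure,
      lintegral_dirac' _ ((transKernel p).measurable_coe hA),
      lintegral_dirac' _ ((transKernel p).measurable_coe hA), transKernel_zero hp0,
      transKernel_one hp1]
    rfl

lemma exists_convexComb_of_ae {ν : Measure I} [IsProbabilityMeasure ν]
    (h : ∀ᵐ x ∂ν, x = 0 ∨ x = 1) :
    ∃ s : ℝ, 0 ≤ s ∧ s ≤ 1 ∧
      ν = ENNReal.ofReal (1 - s) • Measure.dirac 0 + ENNReal.ofReal s • Measure.dirac 1 := by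
  have hset : ({0}ᶜ : Set I) =ᵐ[ν] ({1} : Set I) := by
    filter_upwards [h] with x hx
    refine propext ⟨fun h0 => hx.resolve_left h0, fun h1 h0 => ?_⟩
    exact zero_ne_one ((show x = 0 from h0).symm.trans h1)
  have e : ν = ν {0} • Measure.dirac 0 + ν {1} • Measure.dirac 1 := by
    rw [← Measure.restrict_singleton, ← Measure.restrict_singleton,
      ← Measure.restrict_congr_set hset,
      Measure.restrict_add_restrict_compl (measurableSet_singleton (0 : I))]
  have hsum : ν.real {0} + ν.real {1} = 1 := by
    have := congrArg (fun μ : Measure I => μ Set.univ) e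
    simp only [Measure.add_apply, Measure.smul_apply, measure_univ, smul_eq_mul, mul_one] at this
    rw [measureReal_def, measureReal_def, ← ENNReal.toReal_add (measure_ne_top _ _)
      (measure_ne_top _ _), ← this, ENNReal.toReal_one]
  refine ⟨ν.real {1}, measureReal_nonneg, measureReal_le_one, ?_⟩
  rw [← hsum, add_sub_cancel_right, measureReal_def, measureReal_def,
    ENNReal.ofReal_toReal (measure_ne_top _ _), ENNReal.ofReal_toReal (measure_ne_top _ _)]
  exact e

lemma eq_zero_or_one_of_lyapunov {α : ℝ≥0} (hα : 0 < α) {V : I → ℝ}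
    (hx : ∀ x : I, min ((x : ℝ) ^ (α : ℝ)) ((1 - x : ℝ) ^ (α : ℝ)) ≤ V x) {x : I} (h : V x = 0) :
    x = 0 ∨ x = 1 := by
  have h2 := hx x
  have hα' := NNReal.coe_ne_zero.2 hα.ne'
  rw [h, min_le_iff] at h2
  rcases h2 with h2 | h2
  · left
    have := h2.antisymm (Real.rpow_nonneg x.2.1 _)
    rw [Real.rpow_eq_zero x.2.1 hα'] at this
    exact Subtype.ext this
  · right
    have hx1 : 0 ≤ 1 - (x : ℝ) := sub_nonneg.2 x.2.2
    have := h2.antisymm (Real.rpow_nonneg hx1 _)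
    rw [Real.rpow_eq_zero hx1 hα'] at this
    exact Subtype.ext (sub_eq_zero.1 this).symm

/-- Hölder continuity measured from each of the two zeros gives both terms of the minimum. This is
how a function vanishing at the absorbing points comes under the control of `V`. -/
lemma norm_le_of_vanishing {α : ℝ≥0} {V : I → ℝ}
    (hx : ∀ x : I, min ((x : ℝ) ^ (α : ℝ)) ((1 - x : ℝ) ^ (α : ℝ)) ≤ V x) {ψ : I → ℂ} {N : ℝ}
    (hN : 0 ≤ N) (hψ : ∀ x y : I, dist (ψ x) (ψ y) ≤ N * |(x : ℝ) - y| ^ (α : ℝ))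
    (h0 : ψ 0 = 0) (h1 : ψ 1 = 0) (x : I) : ‖ψ x‖ ≤ N * V x := by
  refine le_trans ?_ (mul_le_mul_of_nonneg_left (hx x) hN)
  rw [mul_min_of_nonneg _ _ hN]
  refine le_min ?_ ?_
  · simpa [h0, abs_of_nonneg x.2.1] using hψ x 0
  · have := hψ x 1
    rwa [h1, dist_zero_right, abs_sub_comm, Set.Icc.coe_one, abs_of_nonneg (sub_nonneg.2 x.2.2)]
      at this

/-- Uniqueness of the harmonic function with given boundary values. -/
lemma eq_of_harmonic {α : ℝ≥0} (hα : 0 < α) {p : C(I, I)} (hp : MemHolder α p)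
    (hp0 : p 0 = 1) (hp1 : qWeight p 1 = 1) {g h : I → ℂ} (hg : MemHolder α g)
    (hh : MemHolder α h) (hQg : transOp p g = g) (hQh : transOp p h = h) (e0 : g 0 = h 0)
    (e1 : g 1 = h 1) : g = h := by
  obtain ⟨V, ρ, hVc, hV0, hV1, hx, hρ0, hρ1, hKV⟩ := exists_lyapunov_both hα hp hp0 hp1
  obtain ⟨N, hN, hψ⟩ := memHolder_iff_exists.1 (memHolder_sub hg hh)
  funext x
  have hb := norm_le_of_vanishing hx hN hψ (by simp [e0]) (by simp [e1])
  have hn : ∀ n : ℕ, ‖g x - h x‖ ≤ N * ρ ^ n := fun n => by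
    have := norm_transOp_iterate_le_of_lyapunov p hVc.measurable hV0 hV1 hρ0 hKV hN hb n x
    rw [transOp_iterate_sub hα hp hg hh, Function.iterate_fixed hQg,
      Function.iterate_fixed hQh] at this
    exact this.trans (mul_le_of_le_one_right (by positivity) (hV1 x))
  have hlim : Tendsto (fun n : ℕ => N * ρ ^ n) atTop (𝓝 0) := by
    simpa using (tendsto_pow_atTop_nhds_zero_of_lt_one hρ0 hρ1).const_mul N
  have := ge_of_tendsto' hlim hn
  exact sub_eq_zero.1 (norm_le_zero_iff.1 this)

/-- The identity `ι` has the right boundary values and is `α`-Hölder because `α ≤ 1`. As `ι - Q ι`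
vanishes at both ends, the increments of `Q^n ι` decay geometrically; the limit inherits a uniform
Hölder bound. -/
lemma exists_harmonic {α : ℝ≥0} (hα : 0 < α) (hα1 : α ≤ 1) {p : C(I, I)} (hp : MemHolder α p)
    (hp0 : p 0 = 1) (hp1 : qWeight p 1 = 1) :
    ∃ g : I → ℂ, MemHolder α g ∧ transOp p g = g ∧ g 0 = 0 ∧ g 1 = 1 := by
  obtain ⟨V, ρ, hVc, hV0, hV1, hx, hρ0, hρ1, hKV⟩ := exists_lyapunov_both hα hp hp0 hp1
  obtain ⟨K, hK0, hK⟩ := exists_weight_bound hp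
  have hr0 := holderRate_pos α
  have hr1 := sub_pos.2 (holderRate_lt_one hα)
  set ι : I → ℂ := fun x => ((x : ℝ) : ℂ)
  have hιd : ∀ x y : I, dist (ι x) (ι y) ≤ 1 * |(x : ℝ) - y| ^ (α : ℝ) := fun x y => by
    simp only [ι]
    rw [Complex.dist_of_im_eq (by simp), one_mul, Complex.ofReal_re, Complex.ofReal_re,
      Real.dist_eq]
    have hle : |(x : ℝ) - y| ≤ 1 := by
      rw [abs_le]
      constructor <;> linarith [x.2.1, x.2.2, y.2.1, y.2.2]
    exact Real.self_le_rpow_of_le_one (abs_nonneg _) hle (by exact_mod_cast hα1)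
  have hι : MemHolder α ι := memHolder_iff_exists.2 ⟨1, zero_le_one, hιd⟩
  have hι1 : ∀ x, ‖ι x‖ ≤ 1 := fun x => by
    simp only [ι]
    rw [Complex.norm_real, Real.norm_of_nonneg x.2.1]
    exact x.2.2
  have hit := memHolder_transOp_iterate hα hp hι
  have hQι := memHolder_transOp hα hp hι
  have hιc := continuous_of_memHolder hα hι
  obtain ⟨N, hN, hψ⟩ := memHolder_iff_exists.1 (memHolder_sub hι hQι)
  have hb := norm_le_of_vanishing hx hN hψ
    (by simp [transOp_absorbing (transKernel_zero hp0) hιc])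
    (by simp [transOp_absorbing (transKernel_one hp1) hιc])
  have hstep : ∀ x (n : ℕ), dist ((transOp p)^[n] ι x) ((transOp p)^[n + 1] ι x) ≤ N * ρ ^ n := by
    intro x n
    have := norm_transOp_iterate_le_of_lyapunov p hVc.measurable hV0 hV1 hρ0 hKV hN hb n x
    rw [transOp_iterate_sub hα hp hι hQι] at this
    rw [dist_eq_norm, Function.iterate_succ_apply]
    exact this.trans (mul_le_of_le_one_right (by positivity) (hV1 x))
  have hlim : ∀ x, ∃ z, Tendsto (fun n => (transOp p)^[n] ι x) atTop (𝓝 z) := fun x =>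
    cauchySeq_tendsto_of_complete (cauchySeq_of_le_geometric ρ N hρ1 (hstep x))
  choose g hg using hlim
  -- Large enough that `holderRate α * D + 2 * K ≤ D`: the Doeblin–Fortet induction then runs with
  -- rate `1`, giving a bound uniform in `n`.
  set D := 1 + 2 * K / (1 - holderRate α)
  have hD : 0 ≤ D := by positivity
  have hdist : ∀ n (x y : I), dist ((transOp p)^[n] ι x) ((transOp p)^[n] ι y)
      ≤ D * 1 ^ n * |(x : ℝ) - y| ^ (α : ℝ) := by
    refine fun n => dist_transOp_iterate_le hα hp hK hι zero_le_one (A := 1)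
      (fun n x => by simpa using norm_transOp_iterate_le p hι1 n x) (fun x y => ?_) ?_ n
    · refine (hιd x y).trans ?_
      gcongr
      simp only [D]
      have : 0 ≤ 2 * K / (1 - holderRate α) := by positivity
      linarith
    · have : (1 - holderRate α) * D = 1 - holderRate α + 2 * K := by
        simp only [D]
        field_simp
      linarith
  have hgm : MemHolder α g := memHolder_iff_exists.2 ⟨D, hD, fun x y =>
    le_of_tendsto' ((hg x).dist (hg y)) fun n => by simpa using hdist n x y⟩
  have hfix : ∀ e : I, transKernel p e = Measure.dirac e → g e = ι e := by
    intro e he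
    refine tendsto_nhds_unique (hg e) ?_
    have : ∀ n, (transOp p)^[n] ι e = ι e := by
      intro n
      induction n with
      | zero => rfl
      | succ n ih =>
        rw [Function.iterate_succ_apply',
          transOp_absorbing he (continuous_of_memHolder hα (hit n)), ih]
    simp only [this]
    exact tendsto_const_nhds
  refine ⟨g, hgm, ?_, by simp [hfix 0 (transKernel_zero hp0), ι],
    by simp [hfix 1 (transKernel_one hp1), ι]⟩
  funext x
  refine tendsto_nhds_unique ?_ ((tendsto_add_atTop_iff_nat 1).2 (hg x))
  simp only [Function.iterate_succ_apply']
  rw [transOp_eq_of_continuous p (continuous_of_memHolder hα hgm)]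
  have e : ∀ n, transOp p ((transOp p)^[n] ι) x = ∫ y, (transOp p)^[n] ι y ∂(transKernel p x) :=
    fun n => transOp_eq_of_continuous p (continuous_of_memHolder hα (hit n)) x
  simp only [e]
  refine tendsto_integral_of_dominated_convergence (fun _ => 1)
    (fun n => (continuous_of_memHolder hα (hit n)).measurable.aestronglyMeasurable)
    (integrable_const 1) (fun n => Eventually.of_forall fun y => norm_transOp_iterate_le p hι1 n y)
    (Eventually.of_forall hg)

lemma transOp_conj (p : C(I, I)) (φ : I → ℂ) :
    transOp p (fun x => (starRingEnd ℂ) (φ x)) = fun x => (starRingEnd ℂ) (transOp p φ x) := by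
  funext x
  simp only [transOp, map_add, map_mul, Complex.conj_ofReal, integral_conj]

/-- The harmonic function with boundary values `0` and `1` is real-valued. -/
lemma exists_real_harmonic {α : ℝ≥0} (hα : 0 < α) (hα1 : α ≤ 1) {p : C(I, I)} (hp : MemHolder α p)
    (hp0 : p 0 = 1) (hp1 : qWeight p 1 = 1) :
    ∃ h : I → ℝ, MemHolder α (fun x => (h x : ℂ)) ∧
      transOp p (fun x => (h x : ℂ)) = (fun x => (h x : ℂ)) ∧ h 0 = 0 ∧ h 1 = 1 := by
  obtain ⟨g, hg, hQg, h0, h1⟩ := exists_harmonic hα hα1 hp hp0 hp1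
  have hc : MemHolder α (fun x => (starRingEnd ℂ) (g x)) := by
    obtain ⟨C, hC0, hC⟩ := memHolder_iff_exists.1 hg
    exact memHolder_iff_exists.2 ⟨C, hC0, fun x y => by rw [Complex.dist_conj_conj]; exact hC x y⟩
  -- The boundary values are real, so the conjugate solves the same problem and uniqueness applies.
  have e := eq_of_harmonic hα hp hp0 hp1 hc hg (by rw [transOp_conj, hQg]) hQg (by simp [h0])
    (by simp [h1])
  have hre : (fun x => ((g x).re : ℂ)) = g := by
    funext x
    exact Complex.conj_eq_iff_re.1 (congrFun e x)
  refine ⟨fun x => (g x).re, by rwa [hre], by rwa [hre], by simp [h0], by simp [h1]⟩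

/-- `L φ` is fixed by `Q` and has the boundary values of `φ`, so `V` controls `φ - L φ`. Its Hölder
bound comes from `L φ x - L φ y = (h x - h y) (φ 1 - φ 0)`. -/
lemma convergesExponentially_harmonic {α : ℝ≥0} (hα : 0 < α) {p : C(I, I)} (hp : MemHolder α p)
    (hp0 : p 0 = 1) (hp1 : qWeight p 1 = 1) {h : I → ℂ} (hh : MemHolder α h)
    (hQh : transOp p h = h) (h0 : h 0 = 0) (h1 : h 1 = 1) :
    ConvergesExponentially α p (fun φ x => (1 - h x) * φ 0 + h x * φ 1) := by
  obtain ⟨V, ρ, hVc, hV0, hV1, hx, hρ0, hρ1, hKV⟩ := exists_lyapunov_both hα hp hp0 hp1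
  obtain ⟨H, hH0, hH⟩ := memHolder_iff_exists.1 hh
  have hhc := continuous_of_memHolder hα hh
  have hL : ∀ φ : I → ℂ, MemHolder α φ → ∀ x y : I,
      dist ((1 - h x) * φ 0 + h x * φ 1) ((1 - h y) * φ 0 + h y * φ 1)
        ≤ (2 * H) * holderNorm α φ * |(x : ℝ) - y| ^ (α : ℝ) := by
    intro φ hφ x y
    have e : (1 - h x) * φ 0 + h x * φ 1 - ((1 - h y) * φ 0 + h y * φ 1)
        = (h x - h y) * (φ 1 - φ 0) := by ring
    rw [dist_eq_norm, e, norm_mul, ← dist_eq_norm]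
    have h2 : ‖φ 1 - φ 0‖ ≤ 2 * holderNorm α φ := (norm_sub_le _ _).trans (by
      linarith [norm_le_holderNorm hα hφ 0, norm_le_holderNorm hα hφ 1])
    calc _ ≤ (H * |(x : ℝ) - y| ^ (α : ℝ)) * (2 * holderNorm α φ) :=
          mul_le_mul (hH x y) h2 (norm_nonneg _) (by positivity)
      _ = _ := by ring
  have hQL : ∀ φ : I → ℂ, MemHolder α φ → transOp p (fun x => (1 - h x) * φ 0 + h x * φ 1)
      = fun x => (1 - h x) * φ 0 + h x * φ 1 := by
    intro φ _
    have e : (fun x => (1 - h x) * φ 0 + h x * φ 1) = fun x => φ 0 + h x * (φ 1 - φ 0) := by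
      funext x
      ring
    rw [e]
    funext x
    rw [transOp_eq_of_continuous p (by fun_prop), integral_add (integrable_const _)
      (integrable_of_continuous (by fun_prop) _), integral_mul_const,
      ← transOp_eq_of_continuous p hhc, hQh]
    simp
  refine convergesExponentially_of_sup hα hp (Λ := 2 * H) (κ := 1 + 2 * H) (by positivity) hρ0 hρ1
    (by positivity) hL hQL fun φ hφ n x => ?_
  have hN := holderNorm_nonneg α φ
  set Lφ : I → ℂ := fun x => (1 - h x) * φ 0 + h x * φ 1
  have hLm : MemHolder α Lφ := memHolder_iff_exists.2 ⟨_, by positivity, hL φ hφ⟩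
  have e1 : (transOp p)^[n] φ x - Lφ x = (transOp p)^[n] (φ - Lφ) x := by
    rw [transOp_iterate_sub hα hp hφ hLm, Function.iterate_fixed (hQL φ hφ)]
    rfl
  rw [e1]
  have hb := norm_le_of_vanishing (ψ := φ - Lφ) (N := (1 + 2 * H) * holderNorm α φ) hx
    (by positivity) (fun x y => by
      refine (dist_sub_sub_le _ _ _ _).trans ((add_le_add (dist_le_holderNorm hφ x y)
        (hL φ hφ x y)).trans (le_of_eq ?_))
      ring) (by simp [Lφ, h0]) (by simp [Lφ, h1])
  refine (norm_transOp_iterate_le_of_lyapunov p hVc.measurable hV0 hV1 hρ0 hKV (by positivity) hb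
    n x).trans ?_
  calc _ ≤ (1 + 2 * H) * holderNorm α φ * ρ ^ n * 1 := by gcongr; exact hV1 x
    _ = _ := by ring

/-! ### The path space and almost sure convergence -/

lemma pathLaw_map_zero (p : C(I, I)) (x : I) :
    (pathLaw p x).map (fun ω => ω 0) = Measure.dirac x := by
  have e : (fun ω : ℕ → I => ω 0) =
      (fun z : (i : Finset.Iic 0) → I => z ⟨0, Finset.mem_Iic.2 le_rfl⟩) ∘
        Preorder.frestrictLe (π := fun _ : ℕ => I) 0 := rfl
  rw [e, ← Measure.map_map (measurable_pi_apply _) (by fun_prop), pathLaw, Kernel.trajMeasure,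
    Measure.map_comp _ _ (by fun_prop), Kernel.traj_map_frestrictLe, Kernel.partialTraj_self,
    Measure.id_comp, Measure.map_map (measurable_pi_apply _) (MeasurableEquiv.measurable _),
    Measure.map_dirac' ((measurable_pi_apply _).comp (MeasurableEquiv.measurable _))]
  rfl

instance (p : C(I, I)) (x : I) : IsProbabilityMeasure (pathLaw p x) := by
  unfold pathLaw
  infer_instance

/-- The Markov property of the chain: the joint law of two consecutive positions. -/
lemma pathLaw_map_pair (p : C(I, I)) (x : I) (n : ℕ) :
    (pathLaw p x).map (fun ω => (ω n, ω (n + 1))) =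
      (pathLaw p x).map (fun ω => ω n) ⊗ₘ transKernel p := by
  set f : ((i : Finset.Iic n) → I) → I := fun z => z ⟨n, Finset.mem_Iic.2 le_rfl⟩
  have hf : Measurable f := measurable_pi_apply _
  have h := Kernel.map_frestrictLe_trajMeasure_compProd_eq_map_trajMeasure (X := fun _ => I)
    (μ₀ := Measure.dirac x)
    (κ := fun n => (transKernel p).comap
      (fun z : (i : Finset.Iic n) → I => z ⟨n, Finset.mem_Iic.2 le_rfl⟩) (measurable_pi_apply _))
    (a := n)
  have hm : Measurable (Prod.map f (id : I → I)) := hf.prodMap measurable_id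
  have h2 := congrArg (fun μ => Measure.map (Prod.map f (id : I → I)) μ) h
  -- The step kernel reads the history only through its last coordinate `f`, so forgetting the rest
  -- of the history leaves `transKernel p`.
  change Measure.map _ (_ ⊗ₘ (transKernel p).comap f hf) = _ at h2
  rw [Measure.map_map hm (by fun_prop)] at h2
  have e : (fun ω : ℕ → I => (ω n, ω (n + 1))) = Prod.map f id ∘
      fun ω => (Preorder.frestrictLe (π := fun _ : ℕ => I) n ω, ω (n + 1)) := rfl
  rw [e]
  refine h2.symm.trans ?_
  have e2 : (pathLaw p x).map (fun ω => ω n) =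
      ((pathLaw p x).map (Preorder.frestrictLe (π := fun _ : ℕ => I) n)).map f := by
    rw [Measure.map_map hf (by fun_prop)]
    rfl
  rw [e2]
  have : IsProbabilityMeasure
      ((pathLaw p x).map (Preorder.frestrictLe (π := fun _ : ℕ => I) n)) :=
    Measure.isProbabilityMeasure_map (by fun_prop)
  have : IsProbabilityMeasure
      (((pathLaw p x).map (Preorder.frestrictLe (π := fun _ : ℕ => I) n)).map f) :=
    Measure.isProbabilityMeasure_map (by fun_prop)
  change Measure.map _ ((pathLaw p x).map _ ⊗ₘ _) = _
  ext s hs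
  rw [Measure.map_apply hm hs, Measure.compProd_apply (hm hs), Measure.compProd_apply hs,
    lintegral_map (Kernel.measurable_kernel_prodMk_left hs) hf]
  rfl

lemma integral_pathLaw_pair (p : C(I, I)) (x : I) (n : ℕ) {g : I → I → ℝ}
    (hg : Measurable (fun z : I × I => g z.1 z.2)) {M : ℝ} (hM : ∀ y z, ‖g y z‖ ≤ M) :
    ∫ ω, g (ω n) (ω (n + 1)) ∂(pathLaw p x)
      = ∫ ω, ∫ y, g (ω n) y ∂(transKernel p (ω n)) ∂(pathLaw p x) := by
  have : IsProbabilityMeasure ((pathLaw p x).map (fun ω => ω n)) :=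
    Measure.isProbabilityMeasure_map (measurable_pi_apply n).aemeasurable
  have hm : Measurable fun ω : ℕ → I => (ω n, ω (n + 1)) := by fun_prop
  have h1 : ∫ ω, g (ω n) (ω (n + 1)) ∂(pathLaw p x)
      = ∫ z, g z.1 z.2 ∂((pathLaw p x).map (fun ω => (ω n, ω (n + 1)))) :=
    (integral_map (f := fun z : I × I => g z.1 z.2) hm.aemeasurable
      hg.aestronglyMeasurable).symm
  rw [h1, pathLaw_map_pair, Measure.integral_compProd
    (Integrable.of_bound hg.aestronglyMeasurable M (Eventually.of_forall fun z => hM _ _)),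
    integral_map (measurable_pi_apply n).aemeasurable]
  exact (hg.stronglyMeasurable.integral_kernel_prod_right' (κ := transKernel p)).aestronglyMeasurable

lemma integral_pathLaw_zero (p : C(I, I)) (x : I) {g : I → ℝ} (hg : Measurable g) :
    ∫ ω, g (ω 0) ∂(pathLaw p x) = g x := by
  have h1 : ∫ ω, g (ω 0) ∂(pathLaw p x) = ∫ z, g z ∂((pathLaw p x).map (fun ω => ω 0)) :=
    (integral_map (measurable_pi_apply 0).aemeasurable hg.aestronglyMeasurable).symm
  rw [h1, pathLaw_map_zero, integral_dirac]

/-- Of the martingale `h(Z_n)` only the constancy of the mean is needed. -/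
lemma integral_pathLaw_harmonic (p : C(I, I)) (x : I) {h : I → ℝ} (hc : Continuous h)
    (hh : ∀ z, ∫ y, h y ∂(transKernel p z) = h z) (n : ℕ) :
    ∫ ω, h (ω n) ∂(pathLaw p x) = h x := by
  obtain ⟨M, hM⟩ := exists_norm_le_of_continuous hc
  induction n with
  | zero => exact integral_pathLaw_zero p x hc.measurable
  | succ n ih =>
    rw [integral_pathLaw_pair p x n (g := fun _ y => h y) (hc.measurable.comp measurable_snd)
      (fun _ y => hM y)]
    simpa only [hh] using ih

lemma integrable_pathLaw {p : C(I, I)} {x : I} {W : I → ℝ} (hW : Measurable W)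
    (h0 : ∀ x, 0 ≤ W x) (h1 : ∀ x, W x ≤ 1) (n : ℕ) :
    Integrable (fun ω => W (ω n)) (pathLaw p x) :=
  Integrable.of_bound (hW.comp (measurable_pi_apply n)).aestronglyMeasurable 1
    (Eventually.of_forall fun ω => by rw [Real.norm_of_nonneg (h0 _)]; exact h1 _)

lemma integral_pathLaw_lyapunov_le (p : C(I, I)) (x : I) {W : I → ℝ} (hW : Measurable W)
    (h0 : ∀ x, 0 ≤ W x) (h1 : ∀ x, W x ≤ 1) {ρ : ℝ} (hρ : 0 ≤ ρ)
    (hKW : ∀ x, ∫ y, W y ∂(transKernel p x) ≤ ρ * W x) (n : ℕ) :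
    ∫ ω, W (ω n) ∂(pathLaw p x) ≤ ρ ^ n := by
  induction n with
  | zero =>
    rw [integral_pathLaw_zero p x hW]
    simpa using h1 x
  | succ n ih =>
    rw [integral_pathLaw_pair p x n (g := fun _ y => W y) (hW.comp measurable_snd) (M := 1)
      (fun _ y => by rw [Real.norm_of_nonneg (h0 y)]; exact h1 y)]
    calc _ ≤ ∫ ω, ρ * W (ω n) ∂(pathLaw p x) :=
          integral_mono_of_nonneg (Eventually.of_forall fun ω => integral_nonneg h0)
            ((integrable_pathLaw hW h0 h1 n).const_mul ρ) (Eventually.of_forall fun ω => hKW _)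
      _ = ρ * ∫ ω, W (ω n) ∂(pathLaw p x) := integral_const_mul _ _
      _ ≤ ρ * ρ ^ n := by gcongr
      _ = ρ ^ (n + 1) := (pow_succ' _ _).symm

/-- The mean displacement in one step is small near absorbing end points. -/
lemma integral_displacement_le {α : ℝ≥0} (hα1 : α ≤ 1) {p : C(I, I)} {K : ℝ} (hK0 : 0 ≤ K)
    (hK : ∀ x y : I, |(p x : ℝ) - p y| ≤ K * |(x : ℝ) - y| ^ (α : ℝ))
    (hp0 : p 0 = 1) (hp1 : qWeight p 1 = 1) (x : I) :
    ∫ y, |(y : ℝ) - x| ∂(transKernel p x)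
      ≤ (1 + K) * min ((x : ℝ) ^ (α : ℝ)) ((1 - x : ℝ) ^ (α : ℝ)) := by
  have hc : Continuous fun y : I => |(y : ℝ) - x| := by fun_prop
  have hb : ∀ y : I, |(y : ℝ) - x| ≤ 1 := fun y => by
    rw [abs_le]
    constructor <;> linarith [x.2.1, x.2.2, y.2.1, y.2.2]
  rw [integral_transKernel_of_bounded p hc.measurable (fun _ => abs_nonneg _) hb]
  have key : ∀ (T : I → I) (c : ℝ), (∀ t, |(T t : ℝ) - x| ≤ c) → Measurable T →
      ∫ t : I, |(T t : ℝ) - x| ≤ c := fun T c h hT => by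
    calc ∫ t : I, |(T t : ℝ) - x| ≤ ∫ t : I, c :=
          integral_mono (integrable_of_bounded (hc.measurable.comp hT) (fun _ => abs_nonneg _)
            (fun _ => hb _) _) (integrable_const _) h
      _ = c := by simp
  have hx0 := x.2.1
  have hx1 : 0 ≤ 1 - (x : ℝ) := sub_nonneg.2 x.2.2
  have e1 := key (fun t => homothety t x) x (fun t => by
    rw [coe_homothety, abs_le]
    constructor <;> nlinarith [t.2.1, t.2.2, mul_nonneg t.2.1 hx0]) (measurable_homothety x)
  have e2 := key (fun t => affineMap t x) (1 - x) (fun t => by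
    rw [coe_affineMap, abs_le]
    constructor <;> nlinarith [t.2.1, t.2.2, mul_nonneg t.2.1 hx1,
      mul_nonneg (sub_nonneg.2 t.2.2) hx1]) (measurable_affineMap x)
  -- Near an end the probable move is short, and the long move has probability of order the `α`-th
  -- power of the distance to that end.
  have hq : 1 - (p x : ℝ) ≤ K * (x : ℝ) ^ (α : ℝ) := by
    have := hK 0 x
    simp only [hp0, Set.Icc.coe_one, Set.Icc.coe_zero, zero_sub, abs_neg] at this
    rw [abs_of_nonneg x.2.1] at this
    exact (le_abs_self _).trans this
  have hp : (p x : ℝ) ≤ K * (1 - x : ℝ) ^ (α : ℝ) := by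
    have h1 : (p 1 : ℝ) = 0 := by
      have : (qWeight p 1 : ℝ) = 1 := by rw [hp1]; rfl
      rw [coe_qWeight] at this
      linarith
    have := hK x 1
    rw [h1, sub_zero, abs_sub_comm, Set.Icc.coe_one, abs_of_nonneg hx1] at this
    exact (le_abs_self _).trans this
  have hα1' : (α : ℝ) ≤ 1 := by exact_mod_cast hα1
  have f1 := Real.self_le_rpow_of_le_one hx0 x.2.2 hα1'
  have f2 := Real.self_le_rpow_of_le_one hx1 (by linarith) hα1'
  have hp0' := (p x).2.1
  have hp1' := (p x).2.2
  have g1 := mul_le_mul_of_nonneg_left e1 hp0'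
  have g2 := mul_le_mul_of_nonneg_left e2 (sub_nonneg.2 hp1')
  refine (add_le_add g1 g2).trans ?_
  rw [mul_min_of_nonneg _ _ (by positivity)]
  refine le_min ?_ ?_
  · have i1 : (p x : ℝ) * x ≤ x := mul_le_of_le_one_left hx0 hp1'
    have i2 : (1 - (p x : ℝ)) * (1 - x) ≤ 1 - p x :=
      mul_le_of_le_one_right (sub_nonneg.2 hp1') (by linarith)
    linarith
  · have i1 : (p x : ℝ) * x ≤ p x := mul_le_of_le_one_right hp0' x.2.2
    have i2 : (1 - (p x : ℝ)) * (1 - x) ≤ 1 - x := mul_le_of_le_one_left hx1 (by linarith)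
    linarith

/-- By Tonelli the sum has finite mean, hence is finite almost surely. -/
lemma ae_summable_of_integral_le {Ω : Type*} [MeasurableSpace Ω] {μ : Measure Ω} {D : ℕ → Ω → ℝ}
    (hD : ∀ n, Integrable (D n) μ) (h0 : ∀ n ω, 0 ≤ D n ω) {c : ℕ → ℝ} (hc : Summable c)
    (hle : ∀ n, ∫ ω, D n ω ∂μ ≤ c n) : ∀ᵐ ω ∂μ, Summable fun n => D n ω := by
  have hm : ∀ n, AEMeasurable (fun ω => ENNReal.ofReal (D n ω)) μ := fun n =>
    (hD n).aemeasurable.ennreal_ofReal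
  have hfin : ∫⁻ ω, ∑' n, ENNReal.ofReal (D n ω) ∂μ ≠ ⊤ := by
    rw [lintegral_tsum hm]
    refine ne_top_of_le_ne_top hc.tsum_ofReal_ne_top (ENNReal.tsum_le_tsum fun n => ?_)
    rw [← ofReal_integral_eq_lintegral_ofReal (hD n) (Eventually.of_forall (h0 n))]
    exact ENNReal.ofReal_le_ofReal (hle n)
  filter_upwards [ae_lt_top' (AEMeasurable.tsum hm) hfin] with ω hω
  refine (ENNReal.summable_toReal hω.ne).congr fun n => ?_
  rw [ENNReal.toReal_ofReal (h0 n ω)]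

/-- Almost every path of the chain with two absorbing end points converges to one of them. -/
lemma ae_tendsto_endpoint {α : ℝ≥0} (hα : 0 < α) (hα1 : α ≤ 1) {p : C(I, I)} (hp : MemHolder α p)
    (hp0 : p 0 = 1) (hp1 : qWeight p 1 = 1) (x : I) :
    ∀ᵐ ω ∂(pathLaw p x), ∃ z : I, (z = 0 ∨ z = 1) ∧ Tendsto (fun n => ω n) atTop (𝓝 z) := by
  obtain ⟨V, ρ, hVc, hV0, hV1, hx, hρ0, hρ1, hKV⟩ := exists_lyapunov_both hα hp hp0 hp1
  obtain ⟨K, hK0, hK⟩ := exists_weight_bound hp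
  have hg : Summable fun n : ℕ => ρ ^ n := summable_geometric_of_lt_one hρ0 hρ1
  have hVi := fun n => integrable_pathLaw (p := p) (x := x) hVc.measurable hV0 hV1 n
  have hVn := integral_pathLaw_lyapunov_le p x hVc.measurable hV0 hV1 hρ0 hKV
  have hb : ∀ y z : I, |(y : ℝ) - z| ≤ 1 := fun y z => by
    rw [abs_le]
    constructor <;> linarith [z.2.1, z.2.2, y.2.1, y.2.2]
  have hdm : Measurable (fun z : I × I => |(z.2 : ℝ) - z.1|) := by fun_prop
  have hDi : ∀ n, Integrable (fun ω : ℕ → I => |(ω (n + 1) : ℝ) - ω n|) (pathLaw p x) := fun n =>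
    Integrable.of_bound (by fun_prop) 1
      (Eventually.of_forall fun ω => by rw [Real.norm_of_nonneg (abs_nonneg _)]; exact hb _ _)
  have hDn : ∀ n, ∫ ω, |(ω (n + 1) : ℝ) - ω n| ∂(pathLaw p x) ≤ (1 + K) * ρ ^ n := fun n => by
    rw [integral_pathLaw_pair p x n (g := fun z y => |(y : ℝ) - z|) hdm (M := 1)
      (fun y z => by rw [Real.norm_of_nonneg (abs_nonneg _)]; exact hb _ _)]
    calc _ ≤ ∫ ω, (1 + K) * V (ω n) ∂(pathLaw p x) := by
          refine integral_mono_of_nonneg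
            (Eventually.of_forall fun ω => integral_nonneg fun _ => abs_nonneg _)
            ((hVi n).const_mul _) (Eventually.of_forall fun ω => ?_)
          refine (integral_displacement_le hα1 hK0 hK hp0 hp1 _).trans ?_
          exact mul_le_mul_of_nonneg_left (hx _) (by positivity)
      _ = (1 + K) * ∫ ω, V (ω n) ∂(pathLaw p x) := integral_const_mul _ _
      _ ≤ _ := by gcongr; exact hVn n
  filter_upwards [ae_summable_of_integral_le hVi (fun n ω => hV0 _) hg hVn,
    ae_summable_of_integral_le hDi (fun n ω => abs_nonneg _) (hg.mul_left (1 + K)) hDn]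
    with ω hω1 hω2
  have hcs : CauchySeq (fun n => ω n) := cauchySeq_of_summable_dist (by
    refine hω2.congr fun n => ?_
    rw [dist_comm]
    rfl)
  obtain ⟨z, hz⟩ := cauchySeq_tendsto_of_complete hcs
  -- Summability also gives `V(Z_n) → 0`, so by continuity the limit is a zero of `V`.
  have hVz := tendsto_nhds_unique ((hVc.tendsto z).comp hz) hω1.tendsto_atTop_zero
  exact ⟨z, eq_zero_or_one_of_lyapunov hα hx hVz, hz⟩

lemma exists_limit {α : ℝ≥0} (hα : 0 < α) (hα1 : α ≤ 1) {p : C(I, I)} (hp : MemHolder α p)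
    (hp0 : p 0 = 1) (hp1 : qWeight p 1 = 1) {h : I → ℝ} (hh : MemHolder α (fun x => (h x : ℂ)))
    (hQh : transOp p (fun x => (h x : ℂ)) = (fun x => (h x : ℂ))) (h0 : h 0 = 0) (h1 : h 1 = 1)
    (x : I) : ∃ Zinf : (ℕ → I) → I, Measurable Zinf ∧ (∀ ω, Zinf ω = 0 ∨ Zinf ω = 1) ∧
      (∀ᵐ ω ∂(pathLaw p x), Tendsto (fun n => ω n) atTop (𝓝 (Zinf ω))) ∧
      (pathLaw p x).real {ω | Zinf ω = 0} = 1 - h x ∧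
      (pathLaw p x).real {ω | Zinf ω = 1} = h x := by
  classical
  have hcC := continuous_of_memHolder hα hh
  have hc : Continuous h := Complex.continuous_re.comp hcC
  have hharm : ∀ z, ∫ y, h y ∂(transKernel p z) = h z := fun z => by
    have := congrFun hQh z
    rw [transOp_eq_of_continuous p hcC, integral_complex_ofReal] at this
    exact_mod_cast this
  -- The default `0` covers convergence to `0` and the null set of remaining paths, making the limit
  -- measurable and `{0,1}`-valued everywhere.
  set Z : (ℕ → I) → I := fun ω => if Tendsto (fun n => ω n) atTop (𝓝 1) then 1 else 0
  have hZm : Measurable Z := Measurable.ite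
    (measurableSet_tendsto (𝓝 (1 : I)) (fun n => measurable_pi_apply n)) measurable_const
    measurable_const
  have hZ : ∀ ω, Z ω = 0 ∨ Z ω = 1 := fun ω => by
    simp only [Z]
    split_ifs
    · exact Or.inr rfl
    · exact Or.inl rfl
  have hlim : ∀ᵐ ω ∂(pathLaw p x), Tendsto (fun n => ω n) atTop (𝓝 (Z ω)) := by
    filter_upwards [ae_tendsto_endpoint hα hα1 hp hp0 hp1 x] with ω ⟨z, hz, hzt⟩
    by_cases ht : Tendsto (fun n => ω n) atTop (𝓝 1)
    · simpa only [Z, if_pos ht] using ht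
    · rcases hz with rfl | rfl
      · simpa only [Z, if_neg ht] using hzt
      · exact absurd hzt ht
  have hm1 : MeasurableSet {ω | Z ω = 1} := hZm (measurableSet_singleton 1)
  have hone : (pathLaw p x).real {ω | Z ω = 1} = h x := by
    obtain ⟨M, hM⟩ := exists_norm_le_of_continuous hc
    -- The means of `h(Z_n)` all equal `h x`, while `h(Z_∞)` is the indicator of `Z_∞ = 1`.
    have ht : Tendsto (fun n => ∫ ω, h (ω n) ∂(pathLaw p x)) atTop
        (𝓝 (∫ ω, h (Z ω) ∂(pathLaw p x))) := by
      refine tendsto_integral_of_dominated_convergence (fun _ => M)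
        (fun n => (hc.measurable.comp (measurable_pi_apply n)).aestronglyMeasurable)
        (integrable_const M) (fun n => Eventually.of_forall fun ω => hM _) ?_
      filter_upwards [hlim] with ω hω
      exact (hc.tendsto _).comp hω
    simp only [integral_pathLaw_harmonic p x hc hharm] at ht
    rw [tendsto_nhds_unique tendsto_const_nhds ht]
    have e : (fun ω => h (Z ω)) = {ω | Z ω = 1}.indicator fun _ => (1 : ℝ) := by
      funext ω
      rcases hZ ω with hω | hω
      · rw [Set.indicator_of_notMem (by simp [hω]), hω, h0]
      · rw [Set.indicator_of_mem (by simpa using hω), hω, h1]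
    rw [e, integral_indicator_const _ hm1]
    simp
  refine ⟨Z, hZm, hZ, hlim, ?_, hone⟩
  have e : {ω | Z ω = 0} = {ω | Z ω = 1}ᶜ := by
    ext ω
    rcases hZ ω with hω | hω <;> simp [hω]
  rw [e, probReal_compl_eq_one_sub hm1, hone]

/-! ### Doeblin minorization when no end point is absorbing -/

lemma continuous_transOp (p : C(I, I)) {φ : I → ℂ} (hφ : Continuous φ) :
    Continuous (transOp p φ) := by
  have key : ∀ T : I → I → I, Continuous (fun z : I × I => T z.1 z.2) →
      Continuous fun x => ∫ t : I, φ (T t x) := by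
    intro T hT
    have h := continuous_parametric_integral_of_continuous (μ := (volume : Measure I))
      (f := fun x t => φ (T t x)) (hφ.comp (hT.comp continuous_swap)) isCompact_univ
    simpa using h
  have h1 := key _ continuous_homothety
  have h2 := key _ continuous_affineMap
  have hp := p.continuous
  unfold transOp qWeight
  fun_prop

lemma continuous_transOp_iterate (p : C(I, I)) {φ : I → ℂ} (hφ : Continuous φ) (n : ℕ) :
    Continuous ((transOp p)^[n] φ) := by
  induction n with
  | zero => exact hφ
  | succ n ih =>
    rw [Function.iterate_succ_apply']
    exact continuous_transOp p ih

lemma projIcc_coe (x : I) : Set.projIcc 0 1 zero_le_one (x : ℝ) = x := Set.projIcc_val _ x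

/-- The point `t x` is uniform on `[0, x]`. Extending `φ` to the line by `Set.projIcc` makes
interval integrals available. -/
lemma integral_homothety (φ : I → ℝ) {x : I} (hx : 0 < (x : ℝ)) :
    ∫ t : I, φ (homothety t x)
      = (x : ℝ)⁻¹ * ∫ s in (0 : ℝ)..x, φ (Set.projIcc 0 1 zero_le_one s) := by
  have e : ∀ t : I, φ (homothety t x) = φ (Set.projIcc 0 1 zero_le_one ((t : ℝ) * x)) := fun t => by
    rw [← coe_homothety, projIcc_coe]
  simp only [e]
  rw [integral_unitInterval (fun t => φ (Set.projIcc 0 1 zero_le_one (t * x))),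
    intervalIntegral.integral_comp_mul_right (fun s => φ (Set.projIcc 0 1 zero_le_one s)) hx.ne']
  simp

lemma integral_affineMap (φ : I → ℝ) {x : I} (hx : (x : ℝ) < 1) :
    ∫ t : I, φ (affineMap t x)
      = (1 - x : ℝ)⁻¹ * ∫ s in (x : ℝ)..1, φ (Set.projIcc 0 1 zero_le_one s) := by
  have e : ∀ t : I, φ (affineMap t x)
      = φ (Set.projIcc 0 1 zero_le_one (1 - (1 - (x : ℝ)) * t)) := fun t => by
    have : 1 - (1 - (x : ℝ)) * t = affineMap t x := by rw [coe_affineMap]; ring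
    rw [this, projIcc_coe]
  simp only [e]
  rw [integral_unitInterval (fun t => φ (Set.projIcc 0 1 zero_le_one (1 - (1 - (x : ℝ)) * t))),
    intervalIntegral.integral_comp_sub_mul (fun s => φ (Set.projIcc 0 1 zero_le_one s))
      (sub_pos.2 hx).ne']
  simp

lemma continuous_extend {E : Type*} [TopologicalSpace E] {φ : I → E} (hφ : Continuous φ) :
    Continuous fun s : ℝ => φ (Set.projIcc 0 1 zero_le_one s) :=
  hφ.comp continuous_projIcc

lemma integral_transKernel_real (p : C(I, I)) {u : I → ℝ} (hu : Continuous u) (x : I) :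
    ∫ y, u y ∂(transKernel p x) = (p x : ℝ) * (∫ t : I, u (homothety t x)) +
      (1 - p x) * (∫ t : I, u (affineMap t x)) := by
  obtain ⟨M, hM⟩ := exists_norm_le_of_continuous hu
  exact integral_transKernel p hu.stronglyMeasurable hM x

lemma integral_extend_mono {u : I → ℝ} (hu : Continuous u) (h0 : ∀ x, 0 ≤ u x) {a b c d : ℝ}
    (hca : c ≤ a) (hab : a ≤ b) (hbd : b ≤ d) :
    ∫ s in a..b, u (Set.projIcc 0 1 zero_le_one s)
      ≤ ∫ s in c..d, u (Set.projIcc 0 1 zero_le_one s) :=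
  intervalIntegral.integral_mono_interval hca hab hbd
    (Eventually.of_forall fun _ => h0 _) ((continuous_extend hu).intervalIntegrable _ _)

/-- From positions close to an end point, one step dominates Lebesgue measure in the middle. -/
lemma le_integral_transKernel_of_end (p : C(I, I)) {s c : ℝ} (hs : 0 < s) (hs4 : s ≤ 1 / 4)
    (hc1 : ∀ x : I, 1 - s ≤ (x : ℝ) → c ≤ p x)
    (hc0 : ∀ x : I, (x : ℝ) ≤ s → c ≤ 1 - p x) {u : I → ℝ} (hu : Continuous u)
    (h0 : ∀ x, 0 ≤ u x) (x : I) (hx : (x : ℝ) ≤ s ∨ 1 - s ≤ (x : ℝ)) :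
    c * ∫ t in s..(1 - s), u (Set.projIcc 0 1 zero_le_one t) ≤ ∫ y, u y ∂(transKernel p x) := by
  rw [integral_transKernel_real p hu]
  have hA : 0 ≤ ∫ t : I, u (homothety t x) := integral_nonneg fun t => h0 _
  have hB : 0 ≤ ∫ t : I, u (affineMap t x) := integral_nonneg fun t => h0 _
  have hp0 := (p x).2.1
  have hp1 := sub_nonneg.2 (p x).2.2
  have hJ : 0 ≤ ∫ t in s..(1 - s), u (Set.projIcc 0 1 zero_le_one t) :=
    intervalIntegral.integral_nonneg (by linarith) fun t _ => h0 _
  rcases hx with hx | hx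
  -- The affine move is uniform on `[x, 1]`, which contains `[s, 1-s]`, with density `1/(1-x) ≥ 1`.
  · refine le_add_of_nonneg_of_le (mul_nonneg hp0 hA) (mul_le_mul (hc0 x hx) ?_ hJ hp1)
    rw [integral_affineMap u (by linarith)]
    have h1 := integral_extend_mono hu h0 hx (show s ≤ 1 - s by linarith)
      (show 1 - s ≤ 1 by linarith)
    have h2 : 1 ≤ (1 - x : ℝ)⁻¹ := (one_le_inv₀ (by linarith)).2 (by linarith [x.2.1])
    exact h1.trans (le_mul_of_one_le_left (hJ.trans h1) h2)
  · refine le_add_of_le_of_nonneg (mul_le_mul (hc1 x hx) ?_ hJ hp0) (mul_nonneg hp1 hB)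
    rw [integral_homothety u (by linarith)]
    have h1 := integral_extend_mono hu h0 hs.le (show s ≤ 1 - s by linarith) hx
    have h2 : 1 ≤ (x : ℝ)⁻¹ := (one_le_inv₀ (by linarith)).2 x.2.2
    exact h1.trans (le_mul_of_one_le_left (hJ.trans h1) h2)

/-- The two end zones are reached with probabilities at least `p x * s` and `(1 - p x) * s`; the
weights add up to `1`, so the bound does not depend on `x`. -/
lemma le_integral_transKernel_of_ends (p : C(I, I)) {s m : ℝ} (hs : 0 < s) (hs4 : s ≤ 1 / 4)
    (hm : 0 ≤ m) {g : I → ℝ} (x : I) (hg : Integrable g (transKernel p x)) (h0 : ∀ x, 0 ≤ g x)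
    (hge : ∀ x : I, (x : ℝ) ≤ s ∨ 1 - s ≤ (x : ℝ) → m ≤ g x) :
    m * s ≤ ∫ y, g y ∂(transKernel p x) := by
  have hmA : MeasurableSet {y : I | (y : ℝ) ≤ s} :=
    measurableSet_le measurable_subtype_coe (by fun_prop)
  have hmB : MeasurableSet {y : I | 1 - s ≤ (y : ℝ)} :=
    measurableSet_le (by fun_prop) measurable_subtype_coe
  have kA := mul_le_mul_of_nonneg_left (le_transKernel_real_le p x hs.le (by linarith)) hm
  have kB := mul_le_mul_of_nonneg_left (le_transKernel_real_ge p x hs.le (by linarith)) hm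
  set A := {y : I | (y : ℝ) ≤ s}
  set B := {y : I | 1 - s ≤ (y : ℝ)}
  have iA : Integrable (A.indicator fun _ => m) (transKernel p x) :=
    (integrable_const m).indicator hmA
  have iB : Integrable (B.indicator fun _ => m) (transKernel p x) :=
    (integrable_const m).indicator hmB
  have hle : ∫ y, (A.indicator (fun _ => m) y + B.indicator (fun _ => m) y) ∂(transKernel p x)
      ≤ ∫ y, g y ∂(transKernel p x) := by
    refine integral_mono (iA.add iB) hg fun y => ?_
    change A.indicator (fun _ => m) y + B.indicator (fun _ => m) y ≤ g y
    by_cases hyA : y ∈ A <;> by_cases hyB : y ∈ B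
    · have h3 : (y : ℝ) ≤ s := hyA
      have h4 : 1 - s ≤ (y : ℝ) := hyB
      linarith
    · rw [Set.indicator_of_mem hyA, Set.indicator_of_notMem hyB, add_zero]
      exact hge y (Or.inl hyA)
    · rw [Set.indicator_of_notMem hyA, Set.indicator_of_mem hyB, zero_add]
      exact hge y (Or.inr hyB)
    · rw [Set.indicator_of_notMem hyA, Set.indicator_of_notMem hyB, add_zero]
      exact h0 y
  rw [integral_add iA iB, integral_indicator_const _ hmA, integral_indicator_const _ hmB] at hle
  simp only [smul_eq_mul] at hle
  linarith

lemma integrable_integral_transKernel (p : C(I, I)) {u : I → ℝ} (hu : Continuous u)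
    (μ : Measure I) [IsProbabilityMeasure μ] :
    Integrable (fun x => ∫ y, u y ∂(transKernel p x)) μ := by
  obtain ⟨M, hM⟩ := exists_norm_le_of_continuous hu
  refine Integrable.of_bound hu.stronglyMeasurable.integral_kernel.aestronglyMeasurable M
    (Eventually.of_forall fun x => ?_)
  simpa using norm_integral_le_of_norm_le_const (μ := transKernel p x) (Eventually.of_forall hM)

/-- Doeblin's minorization for two steps of the chain. -/
lemma le_integral_two_steps (p : C(I, I)) {s c : ℝ} (hs : 0 < s) (hs4 : s ≤ 1 / 4)
    (hc : 0 ≤ c) (hc1 : ∀ x : I, 1 - s ≤ (x : ℝ) → c ≤ p x)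
    (hc0 : ∀ x : I, (x : ℝ) ≤ s → c ≤ 1 - p x) {u : I → ℝ} (hu : Continuous u)
    (h0 : ∀ x, 0 ≤ u x) (x : I) :
    c * s * ∫ t in s..(1 - s), u (Set.projIcc 0 1 zero_le_one t)
      ≤ ∫ z, ∫ y, u y ∂(transKernel p z) ∂(transKernel p x) := by
  have hJ : 0 ≤ ∫ t in s..(1 - s), u (Set.projIcc 0 1 zero_le_one t) :=
    intervalIntegral.integral_nonneg (by linarith) fun t _ => h0 _
  have := le_integral_transKernel_of_ends p hs hs4 (mul_nonneg hc hJ) x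
    (integrable_integral_transKernel p hu _) (fun z => integral_nonneg h0)
    (le_integral_transKernel_of_end p hs hs4 hc1 hc0 hu h0)
  linarith

/-- The minorization applied to `u - a` and to `b - u` raises the lower bound and lowers the upper
one. The integral `J` cancels in the width, which loses the mass `c * s * (1 - 2 * s)` of the
minorizing measure. -/
lemma exists_contraction_two_steps (p : C(I, I)) {s c : ℝ} (hs : 0 < s) (hs4 : s ≤ 1 / 4)
    (hc : 0 ≤ c) (hc1 : ∀ x : I, 1 - s ≤ (x : ℝ) → c ≤ p x)
    (hc0 : ∀ x : I, (x : ℝ) ≤ s → c ≤ 1 - p x) {u : I → ℝ} (hu : Continuous u) {a b : ℝ}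
    (ha : ∀ x, a ≤ u x) (hb : ∀ x, u x ≤ b) :
    ∃ a' b', b' - a' = (1 - c * s * (1 - 2 * s)) * (b - a) ∧
      ∀ x, a' ≤ ∫ z, ∫ y, u y ∂(transKernel p z) ∂(transKernel p x) ∧
        ∫ z, ∫ y, u y ∂(transKernel p z) ∂(transKernel p x) ≤ b' := by
  set J := ∫ t in s..(1 - s), u (Set.projIcc 0 1 zero_le_one t)
  have hi := (continuous_extend hu).intervalIntegrable (μ := volume) s (1 - s)
  refine ⟨a + c * s * (J - (1 - 2 * s) * a), b - c * s * ((1 - 2 * s) * b - J), by ring,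
    fun x => ⟨?_, ?_⟩⟩
  · have h := le_integral_two_steps p hs hs4 hc hc1 hc0 (u := fun y => u y - a) (by fun_prop)
      (fun x => sub_nonneg.2 (ha x)) x
    have e : ∀ z, ∫ y, (u y - a) ∂(transKernel p z) = ∫ y, u y ∂(transKernel p z) - a := fun z => by
      rw [integral_sub (integrable_of_continuous hu _) (integrable_const _)]
      simp
    rw [intervalIntegral.integral_sub hi (by simp), intervalIntegral.integral_const] at h
    simp only [e, smul_eq_mul] at h
    rw [integral_sub (integrable_integral_transKernel p hu _) (integrable_const _)] at h
    simp only [integral_const, probReal_univ, smul_eq_mul, one_mul] at h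
    simp only [J]
    linarith
  · have h := le_integral_two_steps p hs hs4 hc hc1 hc0 (u := fun y => b - u y) (by fun_prop)
      (fun x => sub_nonneg.2 (hb x)) x
    have e : ∀ z, ∫ y, (b - u y) ∂(transKernel p z) = b - ∫ y, u y ∂(transKernel p z) := fun z => by
      rw [integral_sub (integrable_const _) (integrable_of_continuous hu _)]
      simp
    rw [intervalIntegral.integral_sub (by simp) hi, intervalIntegral.integral_const] at h
    simp only [e, smul_eq_mul] at h
    rw [integral_sub (integrable_const _) (integrable_integral_transKernel p hu _)] at h
    simp only [integral_const, probReal_univ, smul_eq_mul, one_mul] at h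
    simp only [J]
    linarith

lemma map_transOp (p : C(I, I)) (l : ℂ →L[ℝ] ℝ) {φ : I → ℂ} (hφ : Continuous φ) (x : I) :
    l (transOp p φ x) = ∫ y, l (φ y) ∂(transKernel p x) := by
  rw [transOp_eq_of_continuous p hφ]
  exact (l.integral_comp_comm (integrable_of_continuous hφ _)).symm

/-- The contraction rests on order, so complex functions are treated through real functionals `l`,
later the real and imaginary parts. -/
lemma exists_band_iterate (p : C(I, I)) {s c : ℝ} (hs : 0 < s) (hs4 : s ≤ 1 / 4)
    (hc : 0 ≤ c) (hc1 : ∀ x : I, 1 - s ≤ (x : ℝ) → c ≤ p x)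
    (hc0 : ∀ x : I, (x : ℝ) ≤ s → c ≤ 1 - p x) (l : ℂ →L[ℝ] ℝ) {φ : I → ℂ} (hφ : Continuous φ)
    {N : ℝ} (hl : ∀ x, |l (φ x)| ≤ N) (n : ℕ) :
    ∃ a b, b - a = 2 * N * (1 - c * s * (1 - 2 * s)) ^ n ∧
      ∀ x, a ≤ l ((transOp p)^[2 * n] φ x) ∧ l ((transOp p)^[2 * n] φ x) ≤ b := by
  induction n with
  | zero => exact ⟨-N, N, by ring, fun x => abs_le.1 (hl x)⟩
  | succ n ih =>
    obtain ⟨a, b, hab, h⟩ := ih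
    have hψ := continuous_transOp_iterate p hφ (2 * n)
    obtain ⟨a', b', hab', h'⟩ := exists_contraction_two_steps p hs hs4 hc hc1 hc0
      (l.continuous.comp hψ) (fun x => (h x).1) (fun x => (h x).2)
    refine ⟨a', b', by rw [hab', hab, pow_succ]; ring, fun x => ?_⟩
    rw [mul_add, mul_one, Function.iterate_succ_apply', Function.iterate_succ_apply',
      map_transOp p l (continuous_transOp p hψ)]
    simp only [map_transOp p l hψ]
    exact h' x

lemma norm_sub_transOp_iterate_even_le (p : C(I, I)) {s c : ℝ} (hs : 0 < s) (hs4 : s ≤ 1 / 4)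
    (hc : 0 ≤ c) (hc1 : ∀ x : I, 1 - s ≤ (x : ℝ) → c ≤ p x)
    (hc0 : ∀ x : I, (x : ℝ) ≤ s → c ≤ 1 - p x) {φ : I → ℂ} (hφ : Continuous φ)
    {N : ℝ} (hN : ∀ x, ‖φ x‖ ≤ N) (n : ℕ) (x y : I) :
    ‖(transOp p)^[2 * n] φ x - (transOp p)^[2 * n] φ y‖
      ≤ 4 * N * (1 - c * s * (1 - 2 * s)) ^ n := by
  obtain ⟨a, b, hab, h⟩ := exists_band_iterate p hs hs4 hc hc1 hc0 Complex.reCLM hφ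
    (fun x => (Complex.abs_re_le_norm _).trans (hN x)) n
  obtain ⟨a', b', hab', h'⟩ := exists_band_iterate p hs hs4 hc hc1 hc0 Complex.imCLM hφ
    (fun x => (Complex.abs_im_le_norm _).trans (hN x)) n
  simp only [Complex.reCLM_apply, Complex.imCLM_apply] at h h'
  refine (Complex.norm_le_abs_re_add_abs_im _).trans ?_
  have e1 : |((transOp p)^[2 * n] φ x - (transOp p)^[2 * n] φ y).re| ≤ b - a := by
    rw [Complex.sub_re, abs_le]
    constructor <;> linarith [(h x).1, (h x).2, (h y).1, (h y).2]
  have e2 : |((transOp p)^[2 * n] φ x - (transOp p)^[2 * n] φ y).im| ≤ b' - a' := by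
    rw [Complex.sub_im, abs_le]
    constructor <;> linarith [(h' x).1, (h' x).2, (h' y).1, (h' y).2]
  linarith

/-- Without absorbing end points, oscillations of the iterates decay exponentially. -/
lemma exists_oscillation_decay {α : ℝ≥0} (hα : 0 < α) {p : C(I, I)} (hp : MemHolder α p)
    (hp0 : p 0 < 1) (hp1 : qWeight p 1 < 1) :
    ∃ κ ρ : ℝ, 0 ≤ κ ∧ 0 ≤ ρ ∧ ρ < 1 ∧ ∀ (φ : I → ℂ), Continuous φ → ∀ N : ℝ,
      (∀ x, ‖φ x‖ ≤ N) → ∀ (n : ℕ) (x y : I),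
        ‖(transOp p)^[n] φ x - (transOp p)^[n] φ y‖ ≤ κ * ρ ^ n * N := by
  obtain ⟨K, hK0, hK⟩ := exists_weight_bound hp
  have hp0' : 0 < 1 - (p 0 : ℝ) := sub_pos.2 hp0
  have hp1' : 0 < (p 1 : ℝ) := by
    have : (qWeight p 1 : ℝ) < 1 := hp1
    rw [coe_qWeight] at this
    linarith
  -- Half the smaller margin: `p` varies by at most `c` over the distance `s` chosen below, so a
  -- margin `c` survives near each end.
  set c := min (1 - (p 0 : ℝ)) (p 1) / 2
  have hc : 0 < c := by positivity
  have hc0 : 2 * c ≤ 1 - p 0 := by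
    simp only [c]
    linarith [min_le_left (1 - (p 0 : ℝ)) (p 1)]
  have hc1 : 2 * c ≤ p 1 := by
    simp only [c]
    linarith [min_le_right (1 - (p 0 : ℝ)) (p 1)]
  obtain ⟨s, hs, hs4, hsK⟩ := exists_small_rpow hα K hc
  have hnear : ∀ e x : I, |(e : ℝ) - x| ≤ s → |(p e : ℝ) - p x| ≤ c := fun e x h =>
    (hK e x).trans ((mul_le_mul_of_nonneg_left
      (Real.rpow_le_rpow (abs_nonneg _) h α.2) hK0).trans hsK)
  have h1 : ∀ x : I, 1 - s ≤ (x : ℝ) → c ≤ p x := fun x hx => by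
    have := hnear 1 x (by
      rw [Set.Icc.coe_one, abs_of_nonneg (sub_nonneg.2 x.2.2)]
      linarith)
    linarith [le_abs_self ((p 1 : ℝ) - p x)]
  have h0 : ∀ x : I, (x : ℝ) ≤ s → c ≤ 1 - p x := fun x hx => by
    have := hnear 0 x (by
      rw [Set.Icc.coe_zero, zero_sub, abs_neg, abs_of_nonneg x.2.1]
      exact hx)
    linarith [neg_abs_le ((p 0 : ℝ) - p x)]
  set θ := 1 - c * s * (1 - 2 * s)
  have hcs : c * s ≤ 1 / 4 := by
    have : c ≤ 1 := by linarith [(p 1).2.2]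
    nlinarith
  have hθ0 : 0 < θ := by
    have : c * s * (1 - 2 * s) ≤ c * s := mul_le_of_le_one_right (by positivity) (by linarith)
    simp only [θ]
    linarith
  have hθ1 : θ < 1 := by
    have : 0 < c * s * (1 - 2 * s) := mul_pos (by positivity) (by linarith)
    simp only [θ]
    linarith
  have hρ : 0 < √θ := Real.sqrt_pos.2 hθ0
  have hρ1 : √θ < 1 := (Real.sqrt_lt' one_pos).2 (by simpa using hθ1)
  -- The factor `θ` is gained every two steps; `1 / √θ` pays for rounding down an odd `n`.
  refine ⟨4 / √θ, √θ, by positivity, hρ.le, hρ1, fun φ hφ N hN n x y => ?_⟩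
  have hN0 : 0 ≤ N := (norm_nonneg _).trans (hN 0)
  have key : ‖(transOp p)^[n] φ x - (transOp p)^[n] φ y‖ ≤ 4 * N * θ ^ (n / 2) := by
    obtain ⟨k, rfl | rfl⟩ := Nat.even_or_odd' n
    · rw [Nat.mul_div_cancel_left k two_pos]
      exact norm_sub_transOp_iterate_even_le p hs hs4 hc.le h1 h0 hφ hN k x y
    · rw [Function.iterate_succ_apply, show (2 * k + 1) / 2 = k by omega]
      exact norm_sub_transOp_iterate_even_le p hs hs4 hc.le h1 h0 (continuous_transOp p hφ)
        (norm_transOp_le p hN) k x y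
  refine key.trans ?_
  have e : θ ^ (n / 2) = √θ ^ (2 * (n / 2)) := by rw [pow_mul, Real.sq_sqrt hθ0.le]
  have h3 : √θ ^ (2 * (n / 2)) ≤ √θ ^ n / √θ := by
    rw [le_div_iff₀ hρ, ← pow_succ]
    exact pow_le_pow_of_le_one hρ.le hρ1.le (by omega)
  rw [e]
  calc _ ≤ 4 * N * (√θ ^ n / √θ) := by gcongr
    _ = _ := by ring

lemma IsInvariantProb.integral_transOp_iterate {p : C(I, I)} {ν : Measure I}
    (hν : IsInvariantProb p ν) {φ : I → ℂ} (hφ : Continuous φ) (n : ℕ) :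
    ∫ x, (transOp p)^[n] φ x ∂ν = ∫ x, φ x ∂ν := by
  induction n with
  | zero => rfl
  | succ n ih =>
    have hc := continuous_transOp_iterate p hφ n
    obtain ⟨M, hM⟩ := exists_norm_le_of_continuous hc
    rw [Function.iterate_succ_apply', ← ih, ← hν.integral_eq hc.stronglyMeasurable hM]
    simp only [transOp_eq_of_continuous p hc]

/-- By invariance `∫ φ dν` is also the `ν`-mean of `Q^n φ`, so its distance to any value of `Q^n φ`
is at most the oscillation. -/
lemma IsInvariantProb.norm_transOp_iterate_sub_le {p : C(I, I)} {ν : Measure I}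
    (hν : IsInvariantProb p ν) {φ : I → ℂ} (hφ : Continuous φ) {n : ℕ} {B : ℝ}
    (hB : ∀ x y : I, ‖(transOp p)^[n] φ x - (transOp p)^[n] φ y‖ ≤ B) (x : I) :
    ‖(transOp p)^[n] φ x - ∫ y, φ y ∂ν‖ ≤ B := by
  have := hν.1
  have hi := integrable_of_continuous (continuous_transOp_iterate p hφ n) ν
  have e : (transOp p)^[n] φ x - ∫ y, φ y ∂ν
      = ∫ y, ((transOp p)^[n] φ x - (transOp p)^[n] φ y) ∂ν := by
    rw [integral_sub (integrable_const _) hi, hν.integral_transOp_iterate hφ]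
    simp
  rw [e]
  simpa using norm_integral_le_of_norm_le_const (μ := ν) (Eventually.of_forall (hB x))

lemma isInvariantProb_unique {α : ℝ≥0} (hα : 0 < α) {p : C(I, I)} (hp : MemHolder α p)
    (hp0 : p 0 < 1) (hp1 : qWeight p 1 < 1) {ν ν' : Measure I} (hν : IsInvariantProb p ν)
    (hν' : IsInvariantProb p ν') : ν' = ν := by
  obtain ⟨κ, ρ, hκ, hρ0, hρ1, h⟩ := exists_oscillation_decay hα hp hp0 hp1
  have := hν.1
  have := hν'.1
  refine ext_of_forall_integral_eq_of_IsFiniteMeasure fun f => ?_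
  have hc : Continuous fun x : I => (f x : ℂ) := Complex.continuous_ofReal.comp f.continuous
  have hN : ∀ x, ‖(f x : ℂ)‖ ≤ ‖f‖ := fun x => by
    rw [Complex.norm_real]
    exact f.norm_coe_le_norm x
  have key : ∀ μ : Measure I, IsInvariantProb p μ →
      Tendsto (fun n => (transOp p)^[n] (fun x => (f x : ℂ)) 0) atTop (𝓝 (∫ x, (f x : ℂ) ∂μ)) := by
    intro μ hμ
    rw [tendsto_iff_norm_sub_tendsto_zero]
    refine squeeze_zero (fun n => norm_nonneg _)
      (fun n => hμ.norm_transOp_iterate_sub_le hc (h _ hc _ hN n) 0) ?_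
    simpa using ((tendsto_pow_atTop_nhds_zero_of_lt_one hρ0 hρ1).const_mul κ).mul_const ‖f‖
  have := tendsto_nhds_unique (key ν' hν') (key ν hν)
  rw [integral_complex_ofReal, integral_complex_ofReal] at this
  exact_mod_cast this

lemma convergesExponentially_of_invariant {α : ℝ≥0} (hα : 0 < α) {p : C(I, I)}
    (hp : MemHolder α p) (hp0 : p 0 < 1) (hp1 : qWeight p 1 < 1) {ν : Measure I}
    (hν : IsInvariantProb p ν) : ConvergesExponentially α p (fun φ _ => ∫ y, φ y ∂ν) := by
  obtain ⟨κ, ρ, hκ, hρ0, hρ1, h⟩ := exists_oscillation_decay hα hp hp0 hp1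
  refine convergesExponentially_of_sup hα hp (Λ := 0) hκ hρ0 hρ1 le_rfl (fun φ _ x y => by simp)
    (fun φ _ => transOp_const p _) fun φ hφ n x => ?_
  have hc := continuous_of_memHolder hα hφ
  exact hν.norm_transOp_iterate_sub_le hc (h φ hc _ (norm_le_holderNorm hα hφ) n) x

/-! ### The stationary density -/

/-- The unnormalized density as a function of a real variable. -/
def realDensity (p : C(I, I)) (x : ℝ) : ℝ :=
  Real.exp ((∫ y in x..(1 / 2), (p (Set.projIcc 0 1 zero_le_one y) : ℝ) / y) +
    ∫ y in (1 / 2)..x, (qWeight p (Set.projIcc 0 1 zero_le_one y) : ℝ) / (1 - y))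

lemma continuous_coe_weight (p : C(I, I)) :
    Continuous fun y : ℝ => (p (Set.projIcc 0 1 zero_le_one y) : ℝ) :=
  continuous_subtype_val.comp (p.continuous.comp continuous_projIcc)

lemma continuousOn_weight_div (p : C(I, I)) :
    ContinuousOn (fun y : ℝ => (p (Set.projIcc 0 1 zero_le_one y) : ℝ) / y) (Set.Ioo 0 1) :=
  (continuous_coe_weight p).continuousOn.div continuousOn_id fun _ hy => hy.1.ne'

lemma continuousOn_qWeight_div (p : C(I, I)) :
    ContinuousOn (fun y : ℝ => (qWeight p (Set.projIcc 0 1 zero_le_one y) : ℝ) / (1 - y))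
      (Set.Ioo 0 1) := by
  have h := continuous_coe_weight p
  simp only [coe_qWeight]
  exact (by fun_prop : Continuous fun y : ℝ =>
    1 - (p (Set.projIcc 0 1 zero_le_one y) : ℝ)).continuousOn.div (by fun_prop)
    fun _ hy => (sub_pos.2 hy.2).ne'

lemma uIcc_subset_Ioo_half {x : ℝ} (hx : x ∈ Set.Ioo (0 : ℝ) 1) :
    Set.uIcc x (1 / 2) ⊆ Set.Ioo 0 1 :=
  Set.OrdConnected.uIcc_subset Set.ordConnected_Ioo hx ⟨by norm_num, by norm_num⟩

lemma hasDerivAt_realDensity (p : C(I, I)) {x : ℝ} (hx : x ∈ Set.Ioo (0 : ℝ) 1) :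
    HasDerivAt (realDensity p) (realDensity p x *
      (-((p (Set.projIcc 0 1 zero_le_one x) : ℝ) / x) +
        (qWeight p (Set.projIcc 0 1 zero_le_one x) : ℝ) / (1 - x))) x := by
  have hn : Set.Ioo (0 : ℝ) 1 ∈ 𝓝 x := isOpen_Ioo.mem_nhds hx
  have c1 := continuousOn_weight_div p
  have c2 := continuousOn_qWeight_div p
  have d1 := intervalIntegral.integral_hasDerivAt_left
    ((c1.mono (uIcc_subset_Ioo_half hx)).intervalIntegrable)
    (c1.stronglyMeasurableAtFilter isOpen_Ioo x hx) (c1.continuousAt hn)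
  have d2 := intervalIntegral.integral_hasDerivAt_right
    ((c2.mono (Set.uIcc_comm x (1 / 2) ▸ uIcc_subset_Ioo_half hx)).intervalIntegrable)
    (c2.stronglyMeasurableAtFilter isOpen_Ioo x hx) (c2.continuousAt hn)
  exact (d1.add d2).exp

lemma continuousOn_realDensity (p : C(I, I)) : ContinuousOn (realDensity p) (Set.Ioo 0 1) :=
  fun _ hx => (hasDerivAt_realDensity p hx).continuousAt.continuousWithinAt

lemma realDensity_pos (p : C(I, I)) (x : ℝ) : 0 < realDensity p x := Real.exp_pos _

/-- The substitution `y ↦ 1 - y` exchanges the two integrals in the exponent, which transfers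
estimates at `0` to `1`. -/
lemma realDensity_reflect (p : C(I, I)) (x : ℝ) :
    realDensity (reflect p) (1 - x) = realDensity p x := by
  have e1 : ∀ y : ℝ, (reflect p (Set.projIcc 0 1 zero_le_one y) : ℝ) / y
      = (fun z : ℝ => (qWeight p (Set.projIcc 0 1 zero_le_one z) : ℝ) / (1 - z)) (1 - y) := by
    intro y
    simp only [reflect_apply, qWeight, symm_projIcc, sub_sub_cancel]
  have e2 : ∀ y : ℝ, (qWeight (reflect p) (Set.projIcc 0 1 zero_le_one y) : ℝ) / (1 - y)
      = (fun z : ℝ => (p (Set.projIcc 0 1 zero_le_one z) : ℝ) / z) (1 - y) := by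
    intro y
    simp only [reflect_apply, qWeight, symm_projIcc, symm_symm]
  rw [realDensity, realDensity]
  simp only [e1, e2]
  rw [intervalIntegral.integral_comp_sub_left
      (fun z : ℝ => (qWeight p (Set.projIcc 0 1 zero_le_one z) : ℝ) / (1 - z)),
    intervalIntegral.integral_comp_sub_left
      (fun z : ℝ => (p (Set.projIcc 0 1 zero_le_one z) : ℝ) / z), add_comm]
  norm_num

/-- By continuity `p` stays below the midpoint of `p 0` and `1` on some `[0, δ]`, and beyond `δ` the
term `y / δ` exceeds `1`. In this form `p(y)/y ≤ c/y + D` integrates explicitly, and `c < 1` gives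
the integrable power `x^(-c)`. -/
lemma exists_linear_bound {α : ℝ≥0} (hα : 0 < α) {p : C(I, I)} (hp : MemHolder α p)
    (hp0 : p 0 < 1) : ∃ c D : ℝ, 0 ≤ c ∧ c < 1 ∧ 0 ≤ D ∧ ∀ y : I, (p y : ℝ) ≤ c + D * y := by
  obtain ⟨K, hK0, hK⟩ := exists_weight_bound hp
  have h0 : 0 < 1 - (p 0 : ℝ) := sub_pos.2 hp0
  obtain ⟨δ, hδ, -, hδK⟩ := exists_small_rpow hα K (half_pos h0)
  refine ⟨(1 + p 0) / 2, δ⁻¹, by linarith [(p 0).2.1], by linarith, by positivity, fun y => ?_⟩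
  rcases le_or_gt (y : ℝ) δ with hy | hy
  · have h := hK 0 y
    rw [Set.Icc.coe_zero, zero_sub, abs_neg, abs_of_nonneg y.2.1] at h
    have h2 : K * (y : ℝ) ^ (α : ℝ) ≤ K * δ ^ (α : ℝ) :=
      mul_le_mul_of_nonneg_left (Real.rpow_le_rpow y.2.1 hy α.2) hK0
    have h3 : 0 ≤ δ⁻¹ * (y : ℝ) := mul_nonneg (by positivity) y.2.1
    linarith [neg_abs_le ((p 0 : ℝ) - p y)]
  · have h1 : 1 ≤ δ⁻¹ * (y : ℝ) := by
      rw [inv_mul_eq_div, one_le_div hδ]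
      exact hy.le
    linarith [(p y).2.2, (p 0).2.1]

lemma realDensity_le_near_zero {p : C(I, I)} {c D : ℝ} (hc : 0 ≤ c) (hD : 0 ≤ D)
    (h : ∀ y : I, (p y : ℝ) ≤ c + D * y) {x : ℝ} (hx0 : 0 < x) (hx : x ≤ 1 / 2) :
    realDensity p x ≤ Real.exp D * x ^ (-c) := by
  have hx1 : x ∈ Set.Ioo (0 : ℝ) 1 := ⟨hx0, by linarith⟩
  have hsub := uIcc_subset_Ioo_half hx1
  have hinv : IntervalIntegrable (fun y : ℝ => y⁻¹) volume x (1 / 2) :=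
    (continuousOn_inv₀.mono fun y hy => (hsub hy).1.ne').intervalIntegrable
  have i1 : (∫ y in x..(1 / 2), (p (Set.projIcc 0 1 zero_le_one y) : ℝ) / y)
      ≤ ∫ y in x..(1 / 2), (c * y⁻¹ + D) := by
    refine intervalIntegral.integral_mono_on hx
      (((continuousOn_weight_div p).mono hsub).intervalIntegrable)
      ((hinv.const_mul c).add (by simp)) fun y hy => ?_
    have hy0 : 0 < y := hx0.trans_le hy.1
    have hy1 : y ∈ Set.Icc (0 : ℝ) 1 := ⟨hy0.le, by linarith [hy.2]⟩
    rw [Set.projIcc_of_mem _ hy1, div_le_iff₀ hy0]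
    have := h ⟨y, hy1⟩
    have e : (c * y⁻¹ + D) * y = c + D * y := by field_simp
    rw [e]
    exact this
  have i2 : (∫ y in x..(1 / 2), (c * y⁻¹ + D)) ≤ D + Real.log x * (-c) := by
    rw [intervalIntegral.integral_add (hinv.const_mul c) (by simp),
      intervalIntegral.integral_const_mul, integral_inv_of_pos hx0 (by norm_num),
      intervalIntegral.integral_const, Real.log_div (by norm_num) hx0.ne', smul_eq_mul]
    have hl : Real.log (1 / 2) ≤ 0 := Real.log_nonpos (by norm_num) (by norm_num)
    nlinarith [mul_nonneg hc (neg_nonneg.2 hl), mul_nonneg hD hx0.le]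
  have i3 : (∫ y in (1 / 2)..x, (qWeight p (Set.projIcc 0 1 zero_le_one y) : ℝ) / (1 - y)) ≤ 0 := by
    rw [intervalIntegral.integral_symm]
    refine neg_nonpos.2 (intervalIntegral.integral_nonneg hx fun y hy => ?_)
    exact div_nonneg (qWeight p _).2.1 (by linarith [hy.2])
  rw [realDensity, Real.rpow_def_of_pos hx0, ← Real.exp_add]
  exact Real.exp_le_exp.2 (by linarith)

/-- Near a non-absorbing end point the density is dominated by an integrable power. -/
lemma exists_realDensity_le {α : ℝ≥0} (hα : 0 < α) {p : C(I, I)} (hp : MemHolder α p)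
    (hp0 : p 0 < 1) : ∃ c M : ℝ, c < 1 ∧ 0 ≤ M ∧
      ∀ x : ℝ, 0 < x → x ≤ 1 / 2 → realDensity p x ≤ M * x ^ (-c) := by
  obtain ⟨c, D, hc0, hc1, hD, h⟩ := exists_linear_bound hα hp hp0
  exact ⟨c, Real.exp D, hc1, (Real.exp_pos _).le, fun x h0 h1 =>
    realDensity_le_near_zero hc0 hD h h0 h1⟩

lemma exists_realDensity_le_one {α : ℝ≥0} (hα : 0 < α) {p : C(I, I)} (hp : MemHolder α p)
    (hp1 : qWeight p 1 < 1) : ∃ c M : ℝ, c < 1 ∧ 0 ≤ M ∧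
      ∀ x : ℝ, 1 / 2 ≤ x → x < 1 → realDensity p x ≤ M * (1 - x) ^ (-c) := by
  obtain ⟨c, M, hc, hM, h⟩ := exists_realDensity_le hα (memHolder_reflect hp)
    (by simpa [reflect_apply, qWeight] using hp1)
  refine ⟨c, M, hc, hM, fun x h0 h1 => ?_⟩
  rw [← realDensity_reflect]
  exact h _ (by linarith) (by linarith)

lemma intervalIntegrable_realDensity {α : ℝ≥0} (hα : 0 < α) {p : C(I, I)} (hp : MemHolder α p)
    (hp0 : p 0 < 1) (hp1 : qWeight p 1 < 1) :
    IntervalIntegrable (realDensity p) volume 0 1 := by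
  obtain ⟨c, M, hc, hM, h⟩ := exists_realDensity_le hα hp hp0
  obtain ⟨c', M', hc', hM', h'⟩ := exists_realDensity_le_one hα hp hp1
  have r1 : IntervalIntegrable (fun x : ℝ => M * x ^ (-c)) volume 0 1 :=
    (intervalIntegral.intervalIntegrable_rpow' (by linarith)).const_mul M
  have r2 : IntervalIntegrable (fun x : ℝ => M' * (1 - x) ^ (-c')) volume 0 1 := by
    have := ((intervalIntegral.intervalIntegrable_rpow' (a := 0) (b := 1)
      (r := -c') (by linarith)).comp_sub_left 1).symm
    simp only [sub_self, sub_zero] at this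
    exact this.const_mul M'
  have r := r1.add r2
  rw [intervalIntegrable_iff_integrableOn_Ioo_of_le zero_le_one] at r ⊢
  refine Integrable.mono' r
    ((continuousOn_realDensity p).aestronglyMeasurable measurableSet_Ioo) ?_
  refine (ae_restrict_iff' measurableSet_Ioo).2 (Eventually.of_forall fun x hx => ?_)
  rw [Real.norm_of_nonneg (realDensity_pos p x).le]
  have n1 : 0 ≤ M * x ^ (-c) := mul_nonneg hM (Real.rpow_nonneg hx.1.le _)
  have n2 : 0 ≤ M' * (1 - x) ^ (-c') :=
    mul_nonneg hM' (Real.rpow_nonneg (sub_nonneg.2 hx.2.le) _)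
  change realDensity p x ≤ M * x ^ (-c) + M' * (1 - x) ^ (-c')
  rcases le_total x (1 / 2) with hx2 | hx2
  · exact (h x hx.1 hx2).trans (le_add_of_nonneg_right n2)
  · exact (h' x hx2 hx.2).trans (le_add_of_nonneg_left n1)

lemma tendsto_mul_realDensity_zero {α : ℝ≥0} (hα : 0 < α) {p : C(I, I)} (hp : MemHolder α p)
    (hp0 : p 0 < 1) : Tendsto (fun x => x * realDensity p x) (𝓝[>] 0) (𝓝 0) := by
  obtain ⟨c, M, hc, hM, h⟩ := exists_realDensity_le hα hp hp0
  have hlim : Tendsto (fun x : ℝ => M * x ^ (1 - c)) (𝓝[>] 0) (𝓝 0) := by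
    have := ((Real.continuous_rpow_const (sub_pos.2 hc).le).tendsto 0).const_mul M
    rw [Real.zero_rpow (sub_pos.2 hc).ne', mul_zero] at this
    exact this.mono_left nhdsWithin_le_nhds
  refine squeeze_zero' ?_ ?_ hlim
  · filter_upwards [self_mem_nhdsWithin] with x hx
    exact mul_nonneg (le_of_lt hx) (realDensity_pos p x).le
  · filter_upwards [Ioo_mem_nhdsGT (by norm_num : (0 : ℝ) < 1 / 2)] with x hx
    calc x * realDensity p x ≤ x * (M * x ^ (-c)) := by
          gcongr
          · exact hx.1.le
          · exact h x hx.1 hx.2.le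
      _ = M * x ^ (1 - c) := by
          rw [sub_eq_add_neg, Real.rpow_add hx.1, Real.rpow_one]
          ring

lemma tendsto_mul_realDensity_one {α : ℝ≥0} (hα : 0 < α) {p : C(I, I)} (hp : MemHolder α p)
    (hp1 : qWeight p 1 < 1) :
    Tendsto (fun x => (1 - x) * realDensity p x) (𝓝[<] 1) (𝓝 0) := by
  have h := tendsto_mul_realDensity_zero hα (memHolder_reflect hp)
    (by simpa [reflect_apply, qWeight] using hp1)
  have hs : Tendsto (fun x : ℝ => 1 - x) (𝓝[<] 1) (𝓝[>] 0) := by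
    refine tendsto_nhdsWithin_iff.2 ⟨?_, ?_⟩
    · have : Tendsto (fun x : ℝ => 1 - x) (𝓝 1) (𝓝 (1 - 1)) :=
        (by fun_prop : Continuous fun x : ℝ => 1 - x).tendsto 1
      rw [sub_self] at this
      exact this.mono_left nhdsWithin_le_nhds
    · filter_upwards [self_mem_nhdsWithin] with x hx
      exact Set.mem_Ioi.2 (sub_pos.2 (Set.mem_Iio.1 hx))
  have := h.comp hs
  simpa only [Function.comp_def, realDensity_reflect] using this

/-- The density is stationary for the chain. -/
lemma integral_realDensity_mul {α : ℝ≥0} (hα : 0 < α) {p : C(I, I)} (hp : MemHolder α p)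
    (hp0 : p 0 < 1) (hp1 : qWeight p 1 < 1) {u : I → ℝ} (hu : Continuous u) :
    ∫ x in (0 : ℝ)..1, realDensity p x *
      ((∫ y, u y ∂(transKernel p (Set.projIcc 0 1 zero_le_one x))) -
        u (Set.projIcc 0 1 zero_le_one x)) = 0 := by
  obtain ⟨M, hM⟩ := exists_norm_le_of_continuous hu
  set v : ℝ → ℝ := fun s => u (Set.projIcc 0 1 zero_le_one s)
  have hv : Continuous v := continuous_extend hu
  have hvi : ∀ a b, IntervalIntegrable v volume a b := fun a b => hv.intervalIntegrable a b
  set Φ : ℝ → ℝ := fun x => ∫ s in (0 : ℝ)..x, v s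
  have hΦ : ∀ x, HasDerivAt Φ (v x) x := fun x =>
    intervalIntegral.integral_hasDerivAt_right (hvi 0 x)
      (hv.stronglyMeasurableAtFilter _ _) hv.continuousAt
  have hΦ1 : ∀ x, Φ 1 - Φ x = ∫ s in x..1, v s := fun x =>
    sub_eq_of_eq_add' (intervalIntegral.integral_add_adjacent_intervals (hvi 0 x) (hvi x 1)).symm
  have hb : ∀ a b, |∫ s in a..b, v s| ≤ M * |b - a| := fun a b =>
    intervalIntegral.norm_integral_le_of_norm_le_const fun s _ => hM _
  -- A primitive of the integrand, by the differential equation for the density. The factor `Φ 1 * x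
  -- - Φ x` vanishes linearly at both ends, which offsets a possible blow-up of the density there.
  set G : ℝ → ℝ := fun x => realDensity p x * (Φ 1 * x - Φ x)
  have hG : ∀ x ∈ Set.Ioo (0 : ℝ) 1, HasDerivAt G (realDensity p x *
      ((∫ y, u y ∂(transKernel p (Set.projIcc 0 1 zero_le_one x))) - v x)) x := by
    intro x hx
    have hxI : x ∈ Set.Icc (0 : ℝ) 1 := Set.Ioo_subset_Icc_self hx
    have d := (hasDerivAt_realDensity p hx).mul
      (((hasDerivAt_id x).const_mul (Φ 1)).sub (hΦ x))
    refine d.congr_deriv ?_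
    rw [Set.projIcc_of_mem _ hxI, integral_transKernel_real p hu,
      integral_homothety u (x := ⟨x, hxI⟩) hx.1, integral_affineMap u (x := ⟨x, hxI⟩) hx.2,
      coe_qWeight]
    change _ = realDensity p x * ((p ⟨x, hxI⟩ : ℝ) * (x⁻¹ * Φ x) +
      (1 - (p ⟨x, hxI⟩ : ℝ)) * ((1 - x)⁻¹ * ∫ s in x..1, v s) - v x)
    rw [← hΦ1]
    have h1 : x ≠ 0 := hx.1.ne'
    have h2 : 1 - x ≠ 0 := (sub_pos.2 hx.2).ne'
    simp only [Pi.sub_apply, id, mul_one]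
    field_simp
    ring
  have hint : IntervalIntegrable (fun x => realDensity p x *
      ((∫ y, u y ∂(transKernel p (Set.projIcc 0 1 zero_le_one x))) - v x)) volume 0 1 := by
    have hm : StronglyMeasurable fun x : ℝ =>
        (∫ y, u y ∂(transKernel p (Set.projIcc 0 1 zero_le_one x))) - v x :=
      ((hu.stronglyMeasurable.integral_kernel (κ := transKernel p)).comp_measurable
        continuous_projIcc.measurable).sub hv.stronglyMeasurable
    have hd := intervalIntegrable_realDensity hα hp hp0 hp1
    rw [intervalIntegrable_iff] at hd ⊢
    refine hd.mul_bdd (c := M + M) hm.aestronglyMeasurable (Eventually.of_forall fun x => ?_)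
    refine (norm_sub_le _ _).trans (add_le_add ?_ (hM _))
    simpa using norm_integral_le_of_norm_le_const
      (μ := transKernel p (Set.projIcc 0 1 zero_le_one x)) (Eventually.of_forall hM)
  have hM0 : 0 ≤ M := (norm_nonneg _).trans (hM 0)
  have l0 : Tendsto G (𝓝[>] 0) (𝓝 0) := by
    refine squeeze_zero_norm' ?_
      (by simpa using (tendsto_mul_realDensity_zero hα hp hp0).const_mul (2 * M))
    filter_upwards [Ioo_mem_nhdsGT (zero_lt_one' ℝ)] with x hx
    have b1 := hb 0 1
    have b2 := hb 0 x
    rw [sub_zero, abs_one, mul_one] at b1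
    rw [sub_zero, abs_of_pos hx.1] at b2
    have b3 : |Φ 1 * x - Φ x| ≤ 2 * M * x := by
      refine (abs_sub _ _).trans ?_
      rw [abs_mul, abs_of_pos hx.1]
      have := mul_le_mul_of_nonneg_right b1 hx.1.le
      simp only [Φ]
      linarith
    simp only [G]
    rw [norm_mul, Real.norm_of_nonneg (realDensity_pos p x).le, Real.norm_eq_abs]
    calc _ ≤ realDensity p x * (2 * M * x) :=
          mul_le_mul_of_nonneg_left b3 (realDensity_pos p x).le
      _ = _ := by ring
  have l1 : Tendsto G (𝓝[<] 1) (𝓝 0) := by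
    refine squeeze_zero_norm' ?_
      (by simpa using (tendsto_mul_realDensity_one hα hp hp1).const_mul (2 * M))
    filter_upwards [Ioo_mem_nhdsLT (zero_lt_one' ℝ)] with x hx
    have hx1 : 0 < 1 - x := sub_pos.2 hx.2
    have b1 := hb 0 1
    have b2 := hb x 1
    rw [sub_zero, abs_one, mul_one] at b1
    rw [abs_of_pos hx1] at b2
    have b3 : |Φ 1 * x - Φ x| ≤ 2 * M * (1 - x) := by
      have e : Φ 1 * x - Φ x = (∫ s in x..1, v s) - Φ 1 * (1 - x) := by
        rw [← hΦ1]
        ring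
      rw [e]
      refine (abs_sub _ _).trans ?_
      rw [abs_mul, abs_of_pos hx1]
      have := mul_le_mul_of_nonneg_right b1 hx1.le
      simp only [Φ]
      linarith
    simp only [G]
    rw [norm_mul, Real.norm_of_nonneg (realDensity_pos p x).le, Real.norm_eq_abs]
    calc _ ≤ realDensity p x * (2 * M * (1 - x)) :=
          mul_le_mul_of_nonneg_left b3 (realDensity_pos p x).le
      _ = _ := by ring
  have := intervalIntegral.integral_eq_sub_of_hasDerivAt_of_tendsto zero_lt_one hG hint l0 l1
  rw [sub_self] at this
  exact this

lemma integrable_unnormalizedDensity {α : ℝ≥0} (hα : 0 < α) {p : C(I, I)} (hp : MemHolder α p)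
    (hp0 : p 0 < 1) (hp1 : qWeight p 1 < 1) : Integrable (unnormalizedDensity p) volume := by
  have h := intervalIntegrable_realDensity hα hp hp0 hp1
  rw [intervalIntegrable_iff_integrableOn_Icc_of_le zero_le_one] at h
  exact (measurePreserving_coe.integrable_comp_emb measurableEmbedding_coe).2 h

lemma exists_invariant_density {α : ℝ≥0} (hα : 0 < α) {p : C(I, I)} (hp : MemHolder α p)
    (hp0 : p 0 < 1) (hp1 : qWeight p 1 < 1) :
    ∃ C : ℝ, 0 < C ∧ IsInvariantProb p ((volume : Measure I).withDensity
      (fun x => ENNReal.ofReal (C * unnormalizedDensity p x))) := by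
  have hi := integrable_unnormalizedDensity hα hp hp0 hp1
  have hpos : ∀ x, 0 < unnormalizedDensity p x := fun x => Real.exp_pos _
  have hZ : 0 < ∫ x, unnormalizedDensity p x := by
    rw [integral_pos_iff_support_of_nonneg (fun x => (hpos x).le) hi]
    have : Function.support (unnormalizedDensity p) = Set.univ :=
      Set.eq_univ_of_forall fun x => (hpos x).ne'
    rw [this, measure_univ]
    exact one_pos
  set Z := ∫ x, unnormalizedDensity p x
  have hZi : 0 < Z⁻¹ := inv_pos.2 hZ
  have hnn : ∀ x, 0 ≤ Z⁻¹ * unnormalizedDensity p x := fun x => (mul_pos hZi (hpos x)).le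
  have hCi : Integrable (fun x => Z⁻¹ * unnormalizedDensity p x) volume := hi.const_mul _
  refine ⟨Z⁻¹, hZi, ?_⟩
  set ν := (volume : Measure I).withDensity fun x => ENNReal.ofReal (Z⁻¹ * unnormalizedDensity p x)
  have hprob : IsProbabilityMeasure ν := by
    constructor
    rw [withDensity_apply _ MeasurableSet.univ, Measure.restrict_univ,
      ← ofReal_integral_eq_lintegral_ofReal hCi (Eventually.of_forall hnn), integral_const_mul,
      inv_mul_cancel₀ hZ.ne', ENNReal.ofReal_one]
  refine ⟨hprob, ?_⟩
  have hν : ∀ g : I → ℝ, ∫ x, g x ∂ν = Z⁻¹ * ∫ x, unnormalizedDensity p x * g x := fun g => by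
    rw [integral_withDensity_eq_integral_toReal_smul₀ hCi.aemeasurable.ennreal_ofReal
      (Eventually.of_forall fun _ => ENNReal.ofReal_lt_top), ← integral_const_mul]
    refine integral_congr_ae (Eventually.of_forall fun x => ?_)
    simp only [ENNReal.toReal_ofReal (hnn x), smul_eq_mul, mul_assoc]
  have hbind : IsProbabilityMeasure (ν.bind (transKernel p)) := by
    rw [← Measure.snd_compProd]
    infer_instance
  rw [Kernel.Invariant]
  -- Finite measures are determined by bounded continuous functions, for which invariance is the
  -- vanishing of `∫ f (Q u - u)`.
  refine ext_of_forall_integral_eq_of_IsFiniteMeasure fun f => ?_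
  have hf := f.continuous
  obtain ⟨M, hM⟩ := exists_norm_le_of_continuous hf
  rw [integral_bind_transKernel p ν hf.stronglyMeasurable hM, ← sub_eq_zero,
    ← integral_sub (integrable_integral_transKernel p hf ν) (integrable_of_continuous hf ν), hν]
  have key := integral_realDensity_mul hα hp hp0 hp1 hf
  rw [← integral_unitInterval] at key
  simp only [projIcc_coe] at key
  exact mul_eq_zero_of_right _ key

end DiaconisFriedman

end

/-! ### Assembly of the cases -/

theorem mainTheorem2 (α : ℝ≥0) (hα0 : 0 < α) (hα1 : α ≤ 1) (p : C(I, I)) (hp : MemHolder α p) :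
    -- Case 1
    ((p 0 < 1 ∧ qWeight p 1 < 1) →
      ∃ ν : Measure I, IsInvariantProb p ν ∧ (∀ ν', IsInvariantProb p ν' → ν' = ν) ∧
        (∃ C : ℝ, 0 < C ∧
          ν = (volume : Measure I).withDensity
            (fun x => ENNReal.ofReal (C * unnormalizedDensity p x))) ∧
        ConvergesExponentially α p (fun φ _ => ∫ y, φ y ∂ν)) ∧
    -- Case 2
    ((p 0 = 1 ∧ qWeight p 1 < 1) →
      (∀ ν : Measure I, IsInvariantProb p ν ↔ ν = Measure.dirac 0) ∧
        ConvergesExponentially α p (fun φ _ => φ 0)) ∧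
    -- Case 2, symmetric
    ((p 0 < 1 ∧ qWeight p 1 = 1) →
      (∀ ν : Measure I, IsInvariantProb p ν ↔ ν = Measure.dirac 1) ∧
        ConvergesExponentially α p (fun φ _ => φ 1)) ∧
    -- Case 3
    ((p 0 = 1 ∧ qWeight p 1 = 1) →
      (∀ ν : Measure I, IsInvariantProb p ν ↔
        ∃ s : ℝ, 0 ≤ s ∧ s ≤ 1 ∧
          ν = ENNReal.ofReal (1 - s) • Measure.dirac 0 + ENNReal.ofReal s • Measure.dirac 1) ∧
      ∃ h : I → ℝ,
        (MemHolder α (fun x => (h x : ℂ)) ∧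
          transOp p (fun x => (h x : ℂ)) = (fun x => (h x : ℂ)) ∧ h 0 = 0 ∧ h 1 = 1) ∧
        (∀ g : I → ℂ, MemHolder α g → transOp p g = g → g 0 = 0 → g 1 = 1 →
          g = fun x => (h x : ℂ)) ∧
        (∀ x : I, ∃ Zinf : (ℕ → I) → I, Measurable Zinf ∧
          (∀ ω, Zinf ω = 0 ∨ Zinf ω = 1) ∧
          (∀ᵐ ω ∂(pathLaw p x), Tendsto (fun n => ω n) atTop (𝓝 (Zinf ω))) ∧
          (pathLaw p x).real {ω | Zinf ω = 0} = 1 - h x ∧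
          (pathLaw p x).real {ω | Zinf ω = 1} = h x) ∧
        ConvergesExponentially α p
          (fun φ x => (1 - (h x : ℂ)) * φ 0 + (h x : ℂ) * φ 1)) := by
  refine ⟨fun ⟨hp0, hp1⟩ => ?_, fun ⟨hp0, hp1⟩ => absorbing_zero hα0 hp hp0 hp1,
    fun ⟨hp0, hp1⟩ => absorbing_one hα0 hp hp0 hp1, fun ⟨hp0, hp1⟩ => ⟨fun ν => ⟨fun hν => ?_, ?_⟩, ?_⟩⟩
  · obtain ⟨C, hC, hν⟩ := exists_invariant_density hα0 hp hp0 hp1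
    exact ⟨_, hν, fun ν' hν' => isInvariantProb_unique hα0 hp hp0 hp1 hν hν', ⟨C, hC, rfl⟩,
      convergesExponentially_of_invariant hα0 hp hp0 hp1 hν⟩
  · have := hν.1
    obtain ⟨V, ρ, hVc, hV0, hV1, hx, hρ0, hρ1, hKV⟩ := exists_lyapunov_both hα0 hp hp0 hp1
    refine exists_convexComb_of_ae ?_
    filter_upwards [hν.ae_eq_zero hVc.measurable hV0 hV1 hρ1 hKV] with x hVx
    exact eq_zero_or_one_of_lyapunov hα0 hx hVx
  · rintro ⟨s, hs0, hs1, rfl⟩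
    exact isInvariantProb_convexComb hp0 hp1 hs0 hs1
  · obtain ⟨h, hh, hQh, h0, h1⟩ := exists_real_harmonic hα0 hα1 hp hp0 hp1
    refine ⟨h, ⟨hh, hQh, h0, h1⟩, fun g hg hQg g0 g1 => ?_,
      exists_limit hα0 hα1 hp hp0 hp1 hh hQh h0 h1,
      convergesExponentially_harmonic hα0 hp hp0 hp1 hh hQh (by simp [h0]) (by simp [h1])⟩
    exact eq_of_harmonic hα0 hp hp0 hp1 hg hh hQg hQh (by simp [g0, h0]) (by simp [g1, h1])
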